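/- For a function $\varphi$ of $v\in[-1,1]$ let $\langle\varphi\rangle=\frac12\int_{-1}^1\varphi(v)\,dv$ and $L\varphi(v)=\int_{-1}^1\frac12(\varphi(v')-\varphi(v))\,dv'$, and put $v^\pm=\frac{v\pm|v|}{2}$. Let $\sigma>0$ and $T>0$ be constants. For $\varepsilon>0$ consider the micro-macro system on $[0,T]\times\mathbb R\times[-1,1]$ (constant cross section $\sigma$, kernel $s\equiv\frac12$, no absorption, no source) $$\partial_t\rho+\partial_x\langle vg\rangle=0,\qquad \partial_t g+\frac1\varepsilon(I-\langle\cdot\rangle)(v\,\partial_xg)=\frac{\sigma}{\varepsilon^2}Lg-\frac1{\varepsilon^2}v\,\partial_x\rho,\qquad \langle g\rangle=0 .$$ For $\Delta t,\Delta x>0$ set $t_n=n\Delta t$, $x_i=i\Delta x$, $x_{i+\frac12}=(i+\frac12)\Delta x$ ($n\in\mathbb N$, $i\in\mathbb Z$), and consider the scheme, with $g^n_{i+\frac12}\in L^2([-1,1])$, $$\frac{\rho^{n+1}_i-\rho^n_i}{\Delta t}+\Big\langle v\,\frac{g^{n+1}_{i+\frac12}-g^{n+1}_{i-\frac12}}{\Delta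 x}\Big\rangle=0,$$ $$\frac{g^{n+1}_{i+\frac12}-g^n_{i+\frac12}}{\Delta t}+\frac1{\varepsilon\Delta x}(I-\langle\cdot\rangle)\Big(v^+(g^n_{i+\frac12}-g^n_{i-\frac12})+v^-(g^n_{i+\frac32}-g^n_{i+\frac12})\Big)=\frac{\sigma}{\varepsilon^2}Lg^{n+1}_{i+\frac12}-\frac1{\varepsilon^2}v\,\frac{\rho^n_{i+1}-\rho^n_i}{\Delta x},$$ started from $\rho^0_i=\rho(0,x_i)$ and $g^0_{i+\frac12}(v)=g(0,x_{i+\frac12},v)$. Theorem. For all $\sigma,T>0$ and every $M$ there is a constant $C$, depending only on $\sigma$, $T$ and $M$, such that the following holds for all $\varepsilon,\Delta t,\Delta x>0$ with $$\Delta t\le\frac{\Delta x^2\sigma}{6}+\frac23\varepsilon\Delta x .$$ Let $(\rho,g)$ be a solution of the micro-macro system with $$\rho\in C^2([0,T],H^1(\mathbb R))\cap C^0([0,T],H^3(\mathbb R)),\qquad g\in C^2([0,T],L^2([-1,1],H^1(\mathbb R)))\cap C^0([0,T],L^2([-1,1],H^3(\mathbb R))),$$ whose norms in these four spaces are at most $M$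 (so that $C$ is the same for all $\varepsilon$ when these norms are bounded uniformly in $\varepsilon$). Then the numerical solution given by the scheme satisfies, for every $n\in\mathbb N$ with $n\Delta t\le T$, $$\Big(\sum_{i\in\mathbb Z}|\rho(t_n,x_i)-\rho^n_i|^2\,\Delta x\Big)^{1/2}+\varepsilon\Big(\sum_{i\in\mathbb Z}\big\langle|g(t_n,x_{i+\frac12},\cdot)-g^n_{i+\frac12}|^2\big\rangle\,\Delta x\Big)^{1/2}\le C\big((1+\varepsilon^2)\Delta t+\Delta x^2+\varepsilon\Delta x\big),$$ both sums being finite. -/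

import Mathlib

open MeasureTheory Set
open scoped ContDiff

noncomputable section

namespace MicroMacro

/-! ### Sobolev spaces on the real line -/

/-- `L²(ℝ)`. -/
abbrev L2R : Type := Lp ℝ 2 (volume : Measure ℝ)

/-- `w ∈ L²(ℝ)` is the weak derivative of `u ∈ L²(ℝ)`. -/
def HasWeakDeriv (u w : L2R) : Prop :=
  ∀ φ : ℝ → ℝ, ContDiff ℝ ∞ φ → HasCompactSupport φ →
    ∫ x, u x * deriv φ x = -∫ x, w x * φ x

/-- Pairing with a bounded compactly supported function, as an inner product. -/
lemma integral_mul_eq_inner (u : L2R) {φ : ℝ → ℝ} (hφ : MemLp φ 2 (volume : Measure ℝ)) :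
    ∫ x, u x * φ x = inner ℝ (hφ.toLp φ) u := by
  rw [L2.inner_def]
  refine integral_congr_ae ?_
  filter_upwards [hφ.coeFn_toLp] with x hx
  simp [hx]

lemma memLp_test {φ : ℝ → ℝ} (hφ : ContDiff ℝ ∞ φ) (hc : HasCompactSupport φ) :
    MemLp φ 2 (volume : Measure ℝ) :=
  hφ.continuous.memLp_of_hasCompactSupport hc

lemma memLp_deriv_test {φ : ℝ → ℝ} (hφ : ContDiff ℝ ∞ φ) (hc : HasCompactSupport φ) :
    MemLp (deriv φ) 2 (volume : Measure ℝ) :=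
  (hφ.continuous_deriv (by simp)).memLp_of_hasCompactSupport hc.deriv

lemma hasWeakDeriv_iff (u w : L2R) : HasWeakDeriv u w ↔
    ∀ (φ : ℝ → ℝ) (hφ : ContDiff ℝ ∞ φ) (hc : HasCompactSupport φ),
      inner ℝ ((memLp_deriv_test hφ hc).toLp _) u + inner ℝ ((memLp_test hφ hc).toLp _) w = 0 := by
  refine forall_congr' fun φ => forall_congr' fun hφ => forall_congr' fun hc => ?_
  rw [integral_mul_eq_inner u (memLp_deriv_test hφ hc), integral_mul_eq_inner w (memLp_test hφ hc),
    eq_neg_iff_add_eq_zero]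

/-- `H^k(ℝ)`: the tuples `(u, u', …, u^(k))` of functions of `L²(ℝ)`, each of which is the weak
derivative of the preceding one, with the norm `(∑ j ≤ k, ‖u^(j)‖²)^(1/2)` inherited from
`L²(ℝ)^(k+1)`. -/
def sobolev (k : ℕ) : Submodule ℝ (PiLp 2 (fun _ : Fin (k + 1) => L2R)) where
  carrier := {u | ∀ j : Fin k, HasWeakDeriv (u j.castSucc) (u j.succ)}
  zero_mem' := by
    intro j
    rw [hasWeakDeriv_iff]
    intro φ hφ hc
    simp
  add_mem' := by
    intro a b ha hb j
    have h1 := ha j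
    have h2 := hb j
    rw [hasWeakDeriv_iff] at h1 h2 ⊢
    intro φ hφ hc
    have e1 := h1 φ hφ hc
    have e2 := h2 φ hφ hc
    simp only [PiLp.add_apply, inner_add_right]
    linarith
  smul_mem' := by
    intro c a ha j
    have h1 := ha j
    rw [hasWeakDeriv_iff] at h1 ⊢
    intro φ hφ hc
    have e1 := h1 φ hφ hc
    simp only [PiLp.smul_apply, inner_smul_right]
    linear_combination c * e1

/-- The Sobolev space `H^k(ℝ)` as a normed space. -/
abbrev Sobolev (k : ℕ) : Type := sobolev k

lemma isClosed_sobolev (k : ℕ) :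
    IsClosed (sobolev k : Set (PiLp 2 (fun _ : Fin (k + 1) => L2R))) := by
  have h : (sobolev k : Set (PiLp 2 (fun _ : Fin (k + 1) => L2R))) =
      ⋂ (j : Fin k) (φ : ℝ → ℝ) (hφ : ContDiff ℝ ∞ φ) (hc : HasCompactSupport φ),
        {u | inner ℝ ((memLp_deriv_test hφ hc).toLp _) (u j.castSucc) +
          inner ℝ ((memLp_test hφ hc).toLp _) (u j.succ) = 0} := by
    ext u
    simp only [mem_iInter, mem_ofPred_eq]
    exact forall_congr' fun j => hasWeakDeriv_iff _ _
  rw [h]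
  refine isClosed_iInter fun j => isClosed_iInter fun φ => isClosed_iInter fun hφ =>
    isClosed_iInter fun hc => isClosed_eq ?_ continuous_const
  fun_prop

/-- Completeness of `H^k(ℝ)` (so that Bochner integrals with values in it are meaningful). -/
instance (k : ℕ) : CompleteSpace (Sobolev k) :=
  (isClosed_sobolev k).completeSpace_coe

/-- The `j`-th weak derivative `∂ₓ^j u ∈ L²(ℝ)` of `u ∈ H^k(ℝ)`, `j ≤ k`. -/
def Sobolev.dx {k : ℕ} (j : Fin (k + 1)) (u : Sobolev k) : L2R := u.1 j

/-- The value at `x` of the continuous representative of `u ∈ H^k(ℝ)`, `k ≥ 1`. -/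
def Sobolev.val {k : ℕ} (u : Sobolev k) (x : ℝ) : ℝ :=
  Classical.epsilon
    (fun φ : ℝ → ℝ => Continuous φ ∧ (Sobolev.dx 0 u : ℝ → ℝ) =ᵐ[volume] φ) x

/-- The inclusion `H³(ℝ) ⊂ H¹(ℝ)`. -/
def inclH : Sobolev 3 →L[ℝ] Sobolev 1 where
  toFun u := ⟨WithLp.toLp 2 (fun j : Fin 2 => u.1 (Fin.castLE (by norm_num) j)), by
    intro j
    fin_cases j
    exact u.2 0⟩
  map_add' _ _ := rfl
  map_smul' _ _ := rfl
  cont := by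
    refine Continuous.subtype_mk ?_ _
    fun_prop

/-! ### Functions of the velocity `v ∈ [-1,1]` -/

/-- Lebesgue measure on the velocity interval `[-1,1]`. -/
abbrev velMeasure : Measure ℝ := volume.restrict (Icc (-1) 1)

/-- `L²([-1,1], H^k(ℝ))`. -/
abbrev VelSobolev (k : ℕ) : Type := Lp (Sobolev k) 2 velMeasure

section velocity

variable {E : Type*} [NormedAddCommGroup E] [NormedSpace ℝ E]

/-- The velocity average `⟨φ⟩ = 1/2 ∫_{-1}^1 φ(v) dv`. -/
def velAvg (φ : ℝ → E) : E := (1 / 2 : ℝ) • ∫ v in (-1 : ℝ)..1, φ v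

/-- The scattering operator `L φ(v) = ∫_{-1}^1 s(v,v') (φ(v') - φ(v)) dv'` with kernel `s`. -/
def scatter (s : ℝ → ℝ → ℝ) (φ : ℝ → E) (v : ℝ) : E :=
  ∫ v' in (-1 : ℝ)..1, s v v' • (φ v' - φ v)

end velocity

/-- The constant kernel `s ≡ 1/2`. -/
def halfKernel : ℝ → ℝ → ℝ := fun _ _ => 1 / 2

/-- The inclusion `L²([-1,1], H³(ℝ)) ⊂ L²([-1,1], H¹(ℝ))`. -/
def inclVel : VelSobolev 3 →L[ℝ] VelSobolev 1 := inclH.compLpL 2 velMeasure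

/-! ### The micro-macro system -/

/-- `u : [0,T] → X` is of class `C^m` and all its derivatives of order `≤ m` are bounded in norm
by `M` on `[0,T]`. -/
def IsCmBounded {X : Type*} [NormedAddCommGroup X] [NormedSpace ℝ X] (m : ℕ) (T M : ℝ)
    (u : ℝ → X) : Prop :=
  ContDiffOn ℝ m u (Icc 0 T) ∧
    ∀ j ≤ m, ∀ t ∈ Icc 0 T, ‖iteratedDerivWithin j u (Icc 0 T) t‖ ≤ M

/-- `ρ ∈ C²([0,T],H¹) ∩ C⁰([0,T],H³)` and `g ∈ C²([0,T],L²([-1,1],H¹)) ∩ C⁰([0,T],L²([-1,1],H³))`,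
with the norms in these four spaces bounded by `M`. -/
structure IsRegular (T M : ℝ) (ρ : ℝ → Sobolev 3) (g : ℝ → VelSobolev 3) : Prop where
  rho_C2_H1 : IsCmBounded 2 T M (fun t => inclH (ρ t))
  rho_C0_H3 : IsCmBounded 0 T M ρ
  g_C2_H1 : IsCmBounded 2 T M (fun t => inclVel (g t))
  g_C0_H3 : IsCmBounded 0 T M g

/-- `(ρ, g)` solves, on `[0,T]`, the micro-macro system (constant `σ`, kernel `1/2`, no absorption,
no source)
`∂ₜρ + ∂ₓ⟨v g⟩ = 0`,
`∂ₜg + (1/ε) (I - ⟨·⟩)(v ∂ₓg) = (σ/ε²) L g - (1/ε²) v ∂ₓρ`, with `⟨g⟩ = 0`.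
The equations are equalities in `L²(ℝ)` of functions of `x`, for every `t` (and almost every `v`);
the time derivatives are those of the `H¹`-valued functions of time. -/
structure IsSolution (σ ε T : ℝ) (ρ : ℝ → Sobolev 3) (g : ℝ → VelSobolev 3) : Prop where
  macro_eq : ∀ t ∈ Icc 0 T,
    Sobolev.dx 0 (derivWithin (fun s => inclH (ρ s)) (Icc 0 T) t)
      + Sobolev.dx 1 (velAvg fun v => v • g t v) = 0
  micro_eq : ∀ t ∈ Icc 0 T, ∀ᵐ v ∂velMeasure,
    Sobolev.dx 0 (derivWithin (fun s => inclVel (g s)) (Icc 0 T) t v)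
      + (1 / ε) • (v • Sobolev.dx 1 (g t v) - velAvg fun w => w • Sobolev.dx 1 (g t w))
    = (σ / ε ^ 2) • Sobolev.dx 0 (scatter halfKernel (g t) v)
      - (1 / ε ^ 2) • v • Sobolev.dx 1 (ρ t)
  avg_zero : ∀ t ∈ Icc 0 T, velAvg (g t) = 0

/-! ### The scheme

The space index `i : ℤ` of a quantity defined on the staggered grid stands for `i + 1/2`. -/

/-- The upwind difference `v⁺ (φ_{i+1/2} - φ_{i-1/2}) + v⁻ (φ_{i+3/2} - φ_{i+1/2})`, with
`v^± = (v ± |v|)/2`. -/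
def upwind (φ : ℤ → ℝ → ℝ) (i : ℤ) (v : ℝ) : ℝ :=
  (v + |v|) / 2 * (φ i v - φ (i - 1) v) + (v - |v|) / 2 * (φ (i + 1) v - φ i v)

/-- `ρ n i` and `g n i v` (for `ρ_i^n` and `g_{i+1/2}^n(v)`) satisfy the scheme. -/
structure IsScheme (σ ε Δt Δx : ℝ) (ρ : ℕ → ℤ → ℝ) (g : ℕ → ℤ → ℝ → ℝ) : Prop where
  memLp : ∀ n i, MemLp (g n i) 2 velMeasure
  macro_eq : ∀ n i, (ρ (n + 1) i - ρ n i) / Δt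
    + velAvg (fun v => v * ((g (n + 1) i v - g (n + 1) (i - 1) v) / Δx)) = 0
  micro_eq : ∀ n i, ∀ᵐ v ∂velMeasure,
    (g (n + 1) i v - g n i v) / Δt
      + 1 / (ε * Δx) * (upwind (g n) i v - velAvg (upwind (g n) i))
    = σ / ε ^ 2 * scatter halfKernel (g (n + 1) i) v
      - 1 / ε ^ 2 * (v * ((ρ n (i + 1) - ρ n i) / Δx))

/-- The scheme is started from the point values of the exact solution at time `0`. -/
def HasExactInitialData (Δx : ℝ) (ρ : ℝ → Sobolev 3) (g : ℝ → VelSobolev 3)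
    (ρn : ℕ → ℤ → ℝ) (gn : ℕ → ℤ → ℝ → ℝ) : Prop :=
  (∀ i : ℤ, ρn 0 i = (ρ 0).val (i * Δx)) ∧
    ∀ i : ℤ, ∀ᵐ v ∂velMeasure, gn 0 i v = (g 0 v).val ((i + 1 / 2) * Δx)

/-! ### Discrete norms -/

/-- `∑ μ_i² < ∞`. -/
def IsL2Grid (μ : ℤ → ℝ) : Prop := Summable fun i => μ i ^ 2

/-- `‖μ‖ = (∑ μ_i² Δx)^(1/2)`. -/
def gridNorm (Δx : ℝ) (μ : ℤ → ℝ) : ℝ := √(∑' i, μ i ^ 2 * Δx)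

/-- Every `φ_{i+1/2}` is in `L²([-1,1])` and `∑ ⟨φ_{i+1/2}²⟩ < ∞`. -/
def IsL2VelGrid (φ : ℤ → ℝ → ℝ) : Prop :=
  (∀ i, MemLp (φ i) 2 velMeasure) ∧ Summable fun i => velAvg fun v => φ i v ^ 2

/-- `|||φ||| = (∑ ⟨φ_{i+1/2}²⟩ Δx)^(1/2)`. -/
def velGridNorm (Δx : ℝ) (φ : ℤ → ℝ → ℝ) : ℝ := √(∑' i, velAvg (fun v => φ i v ^ 2) * Δx)

/-- The error `ρ(tₙ, x_i) - ρ_i^n`. -/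
def rhoError (Δt Δx : ℝ) (ρ : ℝ → Sobolev 3) (ρn : ℕ → ℤ → ℝ) (n : ℕ) (i : ℤ) : ℝ :=
  (ρ (n * Δt)).val (i * Δx) - ρn n i

/-- The error `g(tₙ, x_{i+1/2}, v) - g_{i+1/2}^n(v)`. -/
def gError (Δt Δx : ℝ) (g : ℝ → VelSobolev 3) (gn : ℕ → ℤ → ℝ → ℝ) (n : ℕ) (i : ℤ)
    (v : ℝ) : ℝ :=
  (g (n * Δt) v).val ((i + 1 / 2) * Δx) - gn n i v

end MicroMacro

end

/-!
The error of the scheme is bounded by consistency and stability, both uniform in `ε`.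

*Stability* (`energy_step`). Testing the macro equation with `ρⁿ` and the micro equation with
`gⁿ⁺¹` makes the coupling terms cancel, up to `‖ρⁿ⁺¹ - ρⁿ‖²`. This term, and the square that is
produced by the explicit upwind transport, are multiples of `Δt² ⟨|v| (δg)²⟩`, where `δg` is the
difference quotient of `gⁿ⁺¹` and the weight `⟨|v|⟩ = 1/2` gives the constant. The CFL condition is
what is needed for them to be absorbed by the upwind dissipation `ε Δt Δx ⟨|v| (δg)²⟩` and by one
half of the collisional dissipation `σ Δt ⟨(gⁿ⁺¹)²⟩`. The other half controls a residual of the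
micro equation at the cost of `1/σ`, not `1/ε²`. The upwind part of the estimate is a pointwise
inequality in `(i, v)`, up to a flux that telescopes in `i` (`local_energy_inequality`). A discrete
Gronwall inequality then gives `energy_le_of_isPerturbedStep`.

*Consistency* (`exists_macro_residual`, `micro_eq_exact`). The macro equation is expanded at the
time `tₙ₊₁` and the micro equation at `tₙ`, so that only `∂ₜ²ρ`, `∂ₜ²g`, `∂ₜg` have to be sampled at
grid points, which is possible in `H¹(ℝ)` (`isGridBounded_evalL`). The error in space is that of
centred differences, of order `Δx²`, except for the upwind differences, of order `Δx`, which carry a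
factor `ε`. The projection `I - ⟨·⟩` only adds a function independent of `v`, which is orthogonal to
the error of `g` because both the exact and the numerical `g` have zero average.

Sampling costs a factor `1 + Δx²`. For `Δx ≤ 1` it is harmless (`energy_error_le`). For `Δx ≥ 1` the
right-hand side of the estimate dominates the size `(1 + ε) Δx` of the sampled data, and stability
alone suffices (`energy_error_le_of_stability`).

Underlying all this are the continuous representatives of functions in `H¹(ℝ)`: the lemma of
du Bois-Reymond shows that they are primitives of their weak derivatives
(`HasWeakDeriv.exists_representative`).
-/

namespace MicroMacro

/-! ### Continuous representatives -/

/-- A test function of zero integral has a primitive that is a test function. -/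
theorem exists_hasCompactSupport_primitive {χ : ℝ → ℝ} (hχ : ContDiff ℝ ∞ χ)
    (hc : HasCompactSupport χ) (h0 : ∫ x, χ x = 0) :
    ∃ φ : ℝ → ℝ, ContDiff ℝ ∞ φ ∧ HasCompactSupport φ ∧ deriv φ = χ := by
  obtain ⟨R, hR⟩ := hc.isCompact.isBounded.subset_closedBall 0
  rw [Real.closedBall_eq_Icc] at hR
  simp only [zero_sub, zero_add] at hR
  have hz : ∀ x, x ∉ Icc (-R) R → χ x = 0 := fun x hx =>
    image_eq_zero_of_notMem_tsupport fun h => hx (hR h)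
  have hd : ∀ x, HasDerivAt (fun y => ∫ t in (-R)..y, χ t) (χ x) x := fun x =>
    hχ.continuous.integral_hasStrictDerivAt (-R) x |>.hasDerivAt
  have hderiv : deriv (fun y => ∫ t in (-R)..y, χ t) = χ := funext fun x => (hd x).deriv
  refine ⟨fun y => ∫ t in (-R)..y, χ t, ?_, ?_, hderiv⟩
  · rw [contDiff_infty_iff_deriv, hderiv]
    exact ⟨fun x => (hd x).differentiableAt, hχ⟩
  · refine HasCompactSupport.intro (K := Icc (-R) R) isCompact_Icc fun x hx => ?_
    by_cases hRx : -R ≤ x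
    · have hx' : R < x := by
        by_contra! h
        exact hx ⟨hRx, h⟩
      rw [intervalIntegral.integral_of_le hRx, ← h0]
      refine setIntegral_eq_integral_of_ae_compl_eq_zero ?_
      filter_upwards [compl_mem_ae_iff.2 (measure_singleton (-R))] with y hy hy'
      refine hz y fun h => hy' ⟨lt_of_le_of_ne h.1 fun e => hy e.symm, h.2.trans hx'.le⟩
    · push Not at hRx
      rw [intervalIntegral.integral_symm, neg_eq_zero, intervalIntegral.integral_of_le hRx.le]
      refine (setIntegral_congr_ae measurableSet_Ioc (g := fun _ => (0:ℝ)) ?_).trans (by simp)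
      filter_upwards [compl_mem_ae_iff.2 (measure_singleton (-R))] with y hy hy'
      exact hz y fun h => hy (le_antisymm hy'.2 h.1)

/-- The lemma of du Bois-Reymond: a function with zero weak derivative is constant. -/
theorem exists_ae_eq_const_of_integral_mul_deriv_eq_zero {f : ℝ → ℝ}
    (hf : LocallyIntegrable f)
    (h : ∀ φ : ℝ → ℝ, ContDiff ℝ ∞ φ → HasCompactSupport φ → ∫ x, f x * deriv φ x = 0) :
    ∃ c : ℝ, ∀ᵐ x, f x = c := by
  let b : ContDiffBump (0 : ℝ) := ⟨1, 2, one_pos, one_lt_two⟩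
  have hηs : ContDiff ℝ ∞ (b.normed volume) := b.contDiff_normed
  have hηc : HasCompactSupport (b.normed volume) := b.hasCompactSupport_normed
  have hη1 : ∫ x, b.normed volume x = 1 := b.integral_normed
  have int {ψ : ℝ → ℝ} (hψ : ContDiff ℝ ∞ ψ) (hψc : HasCompactSupport ψ) :
      Integrable fun x => f x * ψ x := by
    simpa [mul_comm] using hf.integrable_smul_left_of_hasCompactSupport hψ.continuous hψc
  refine ⟨∫ x, f x * b.normed volume x, ?_⟩
  set c := ∫ x, f x * b.normed volume x
  have key : ∀ᵐ x, f x - c = 0 := by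
    refine ae_eq_zero_of_integral_contDiff_smul_eq_zero
      (hf.sub (locallyIntegrable_const c)) fun ψ hψ hψc => ?_
    have iψ : Integrable ψ := hψ.continuous.integrable_of_hasCompactSupport hψc
    have iη : Integrable (b.normed volume) := hηs.continuous.integrable_of_hasCompactSupport hηc
    -- Subtracting a multiple of a fixed bump makes the integral of the test function vanish.
    obtain ⟨φ, h1, h2, h3⟩ := exists_hasCompactSupport_primitive
      (χ := fun x => ψ x - (∫ y, ψ y) * b.normed volume x)
      (hψ.sub (contDiff_const.mul hηs))
      (by
        have := hψc.sub (hηc.smul_left (f := fun _ => ∫ y, ψ y))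
        exact this)
      (by rw [integral_sub iψ (iη.const_mul _), integral_const_mul, hη1]; ring)
    have h4 := h φ h1 h2
    rw [h3] at h4
    have e1 : ∀ x, f x * (ψ x - (∫ y, ψ y) * b.normed volume x)
        = f x * ψ x - (∫ y, ψ y) * (f x * b.normed volume x) := fun x => by ring
    simp only [e1] at h4
    rw [integral_sub (int hψ hψc) ((int hηs hηc).const_mul _), integral_const_mul] at h4
    have e2 : ∀ x, ψ x • (f x - c) = f x * ψ x - c * ψ x := fun x => by
      simp only [smul_eq_mul]; ring
    simp only [e2]
    rw [integral_sub (int hψ hψc) (iψ.const_mul _), integral_const_mul]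
    linear_combination h4
  filter_upwards [key] with x hx using sub_eq_zero.1 hx

theorem L2R.locallyIntegrable (u : L2R) : LocallyIntegrable (u : ℝ → ℝ) :=
  (Lp.memLp u).locallyIntegrable one_le_two

theorem L2R.intervalIntegrable (u : L2R) (a b : ℝ) : IntervalIntegrable (u : ℝ → ℝ) volume a b :=
  intervalIntegrable_iff.2 <| ((L2R.locallyIntegrable u).integrableOn_isCompact
    isCompact_uIcc).mono_set uIoc_subset_uIcc

/-- Functions in `H¹(ℝ)` have a continuous representative, which satisfies the fundamental theorem
of calculus. -/
theorem HasWeakDeriv.exists_representative {u w : L2R} (h : HasWeakDeriv u w) :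
    ∃ U : ℝ → ℝ, Continuous U ∧ (u : ℝ → ℝ) =ᵐ[volume] U ∧
      ∀ a b, U b - U a = ∫ x in a..b, w x := by
  let W : ℝ → ℝ := fun x => ∫ t in (0:ℝ)..x, w t
  have hWc : Continuous W := intervalIntegral.continuous_primitive
    (fun a b => L2R.intervalIntegrable w a b) 0
  have hWd : ∀ᵐ x, HasDerivAt W (w x) x := by
    filter_upwards [LocallyIntegrable.ae_hasDerivAt_integral (L2R.locallyIntegrable w)] with x hx
    exact hx 0
  have parts : ∀ φ : ℝ → ℝ, ContDiff ℝ ∞ φ → HasCompactSupport φ →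
      ∫ x, W x * deriv φ x = - ∫ x, w x * φ x := by
    intro φ hφ hc
    obtain ⟨R, hR⟩ := hc.isCompact.isBounded.subset_closedBall 0
    rw [Real.closedBall_eq_Icc] at hR
    simp only [zero_sub, zero_add] at hR
    have hz : ∀ x, x ∉ Icc (-R) R → φ x = 0 := fun x hx =>
      image_eq_zero_of_notMem_tsupport fun h => hx (hR h)
    -- Enlarging the interval makes `φ` vanish at its endpoints.
    have hsub : Icc (-R) R ⊆ Ioc (-(|R| + 1)) (|R| + 1) := fun x hx =>
      ⟨by linarith [hx.1, le_abs_self R], by linarith [hx.2, le_abs_self R]⟩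
    have hs1 : Function.support (fun x => W x * deriv φ x) ⊆ Ioc (-(|R| + 1)) (|R| + 1) := by
      refine Subset.trans ?_ hsub
      refine (Function.support_mul_subset_right _ _).trans (Subset.trans ?_ hR)
      exact (subset_tsupport _).trans tsupport_deriv_subset
    have hs2 : Function.support (fun x => w x * φ x) ⊆ Ioc (-(|R| + 1)) (|R| + 1) := by
      refine Subset.trans ?_ hsub
      exact (Function.support_mul_subset_right _ _).trans ((subset_tsupport _).trans hR)
    have hWac : AbsolutelyContinuousOnInterval W (-(|R| + 1)) (|R| + 1) :=
      (L2R.intervalIntegrable w _ _).absolutelyContinuousOnInterval_intervalIntegral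
        (by rw [mem_uIcc]; left; constructor <;> linarith [abs_nonneg R])
    have hφac : AbsolutelyContinuousOnInterval φ (-(|R| + 1)) (|R| + 1) :=
      (hφ.contDiffOn.of_le (by simp)).absolutelyContinuousOnInterval
    rw [← intervalIntegral.integral_eq_integral_of_support_subset hs1,
      ← intervalIntegral.integral_eq_integral_of_support_subset hs2,
      hWac.integral_mul_deriv_eq_deriv_mul hφac, hz (|R| + 1), hz (-(|R| + 1))]
    · simp only [mul_zero, sub_zero, zero_sub, neg_inj]
      refine intervalIntegral.integral_congr_ae ?_
      filter_upwards [hWd] with x hx _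
      rw [hx.deriv]
    · intro h
      linarith [h.1, neg_abs_le R, le_abs_self R]
    · intro h
      linarith [h.2, neg_abs_le R, le_abs_self R]
  obtain ⟨c, hc⟩ := exists_ae_eq_const_of_integral_mul_deriv_eq_zero (f := fun x => u x - W x)
    ((L2R.locallyIntegrable u).sub hWc.locallyIntegrable) (by
      intro φ hφ hc
      have i1 : Integrable fun x => u x * deriv φ x := by
        simpa [mul_comm] using (L2R.locallyIntegrable u).integrable_smul_left_of_hasCompactSupport
          (hφ.continuous_deriv (by simp)) hc.deriv
      have i2 : Integrable fun x => W x * deriv φ x :=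
        (hWc.mul (hφ.continuous_deriv (by simp))).integrable_of_hasCompactSupport hc.deriv.mul_left
      simp only [sub_mul]
      rw [integral_sub i1 i2, parts φ hφ hc, h φ hφ hc, sub_self])
  refine ⟨fun x => c + W x, by fun_prop, ?_, fun a b => ?_⟩
  · filter_upwards [hc] with x hx
    linarith
  · have := intervalIntegral.integral_interval_sub_left (L2R.intervalIntegrable w 0 b)
      (L2R.intervalIntegrable w 0 a)
    simp only [W]
    linarith

/-! ### Point evaluation and sampling in `H¹(ℝ)` -/

namespace Sobolev

theorem exists_val (u : Sobolev 1) : Continuous u.val ∧ (dx 0 u : ℝ → ℝ) =ᵐ[volume] u.val := by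
  obtain ⟨U, h1, h2, -⟩ := HasWeakDeriv.exists_representative (u.2 0)
  exact Classical.epsilon_spec
    (p := fun φ : ℝ → ℝ => Continuous φ ∧ (dx 0 u : ℝ → ℝ) =ᵐ[volume] φ) ⟨U, h1, h2⟩

@[fun_prop]
theorem continuous_val (u : Sobolev 1) : Continuous u.val := (exists_val u).1

theorem dx_zero_ae_eq_val (u : Sobolev 1) : (dx 0 u : ℝ → ℝ) =ᵐ[volume] u.val := (exists_val u).2

theorem val_eq_of_ae_eq (u : Sobolev 1) {φ : ℝ → ℝ} (hφ : Continuous φ)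
    (h : (dx 0 u : ℝ → ℝ) =ᵐ[volume] φ) : u.val = φ :=
  ((continuous_val u).ae_eq_iff_eq volume hφ).1 ((dx_zero_ae_eq_val u).symm.trans h)

/-- The fundamental theorem of calculus in `H¹(ℝ)`. -/
theorem val_sub_val (u : Sobolev 1) (a b : ℝ) :
    u.val b - u.val a = ∫ x in a..b, dx 1 u x := by
  obtain ⟨U, h1, h2, h3⟩ := HasWeakDeriv.exists_representative (u.2 0)
  rw [val_eq_of_ae_eq u h1 h2]
  exact h3 a b

theorem val_congr {u w : Sobolev 1} (h : dx 0 u = dx 0 w) : u.val = w.val :=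
  val_eq_of_ae_eq u (continuous_val w) (h ▸ dx_zero_ae_eq_val w)

theorem val_add (u w : Sobolev 1) : (u + w).val = u.val + w.val := by
  refine val_eq_of_ae_eq _ ((continuous_val u).add (continuous_val w)) ?_
  have : dx 0 (u + w) = dx 0 u + dx 0 w := rfl
  rw [this]
  filter_upwards [Lp.coeFn_add (dx 0 u) (dx 0 w), dx_zero_ae_eq_val u, dx_zero_ae_eq_val w]
    with x h1 h2 h3
  rw [h1, Pi.add_apply, Pi.add_apply, h2, h3]

theorem val_smul (c : ℝ) (u : Sobolev 1) : (c • u).val = c • u.val := by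
  refine val_eq_of_ae_eq _ ((continuous_val u).const_smul c) ?_
  have : dx 0 (c • u) = c • dx 0 u := rfl
  rw [this]
  filter_upwards [Lp.coeFn_smul c (dx 0 u), dx_zero_ae_eq_val u] with x h1 h2
  simp [h1, h2]

theorem norm_sq_eq (u : Sobolev 1) : ‖u‖ ^ 2 = ‖dx 0 u‖ ^ 2 + ‖dx 1 u‖ ^ 2 := by
  have : ‖u‖ = ‖(u : PiLp 2 (fun _ : Fin 2 => L2R))‖ := rfl
  rw [this, PiLp.norm_sq_eq_of_L2, Fin.sum_univ_two]
  rfl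

end Sobolev

theorem L2R.integrable_sq (u : L2R) : Integrable fun x => u x ^ 2 := (Lp.memLp u).integrable_sq

theorem L2R.norm_sq_eq_integral (u : L2R) : ‖u‖ ^ 2 = ∫ x, u x ^ 2 := by
  rw [← real_inner_self_eq_norm_sq, L2.inner_def]
  simp [pow_two]

/-- The Cauchy-Schwarz inequality on a subinterval of a cell of length `h`. -/
theorem L2R.sq_integral_le (w : L2R) {a h p q : ℝ} (hh : 0 < h) (hp : p ∈ Icc a (a + h))
    (hq : q ∈ Icc a (a + h)) :
    (∫ x in p..q, w x) ^ 2 ≤ h * ∫ x in Ioc a (a + h), w x ^ 2 := by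
  wlog hpq : p ≤ q generalizing p q
  · rw [intervalIntegral.integral_symm, neg_sq]
    exact this hq hp (by linarith)
  set S := ∫ x in p..q, w x with hS
  -- Since `q - p ≤ h`, the square with the mean over the whole cell suffices.
  have h1 : 0 ≤ ∫ x in p..q, (w x - S / h) ^ 2 :=
    intervalIntegral.integral_nonneg hpq fun x _ => sq_nonneg _
  have i1 : IntervalIntegrable (fun x => w x) volume p q := L2R.intervalIntegrable w p q
  have i2 : IntervalIntegrable (fun x => w x ^ 2) volume p q :=
    (L2R.integrable_sq w).intervalIntegrable
  have e : ∀ x, (w x - S / h) ^ 2 = w x ^ 2 - (2 * (S / h)) * w x + (S / h) ^ 2 := fun x => by ring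
  simp only [e] at h1
  rw [intervalIntegral.integral_add (i2.sub (i1.const_mul _)) intervalIntegrable_const,
    intervalIntegral.integral_sub i2 (i1.const_mul _), intervalIntegral.integral_const_mul, ← hS,
    intervalIntegral.integral_const, smul_eq_mul] at h1
  have h2 : ∫ x in p..q, w x ^ 2 ≤ ∫ x in Ioc a (a + h), w x ^ 2 := by
    rw [intervalIntegral.integral_of_le hpq]
    exact setIntegral_mono_set (L2R.integrable_sq w).integrableOn
      (Filter.Eventually.of_forall fun x => sq_nonneg _)
      (Ioc_subset_Ioc hp.1 hq.2).eventuallyLE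
  have h3 : (q - p) * (S / h) ^ 2 ≤ h * (S / h) ^ 2 :=
    mul_le_mul_of_nonneg_right (by linarith [hp.1, hq.2]) (sq_nonneg _)
  have h4 : S ^ 2 / h ≤ ∫ x in Ioc a (a + h), w x ^ 2 := by
    have e2 : h * (S / h) ^ 2 = S ^ 2 / h := by field_simp
    have e3 : 2 * (S / h) * S = 2 * (S ^ 2 / h) := by ring
    linarith
  rw [div_le_iff₀ hh] at h4
  linarith

/-- The value at the left end of a cell is compared with the values at all points of the cell, and
the comparison is averaged over the cell. -/
theorem Sobolev.mul_val_sq_le (u : Sobolev 1) {x h : ℝ} (hh : 0 < h) :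
    u.val x ^ 2 * h ≤ 2 * (∫ y in Ioc x (x + h), dx 0 u y ^ 2)
      + 2 * h ^ 2 * ∫ y in Ioc x (x + h), dx 1 u y ^ 2 := by
  set K := ∫ y in Ioc x (x + h), dx 1 u y ^ 2 with hK
  have h1 : ∫ y in Ioc x (x + h), u.val x ^ 2
      ≤ ∫ y in Ioc x (x + h), (2 * dx 0 u y ^ 2 + 2 * (h * K)) := by
    refine integral_mono_ae (integrable_const _) ?_ ?_
    · exact ((L2R.integrable_sq _).integrableOn.const_mul _).add (integrable_const _)
    · filter_upwards [ae_restrict_of_ae (Sobolev.dx_zero_ae_eq_val u),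
        ae_restrict_mem measurableSet_Ioc] with y hy hm
      rw [hy]
      have h2 := L2R.sq_integral_le (dx 1 u) hh (a := x) (p := x) (q := y)
        ⟨le_rfl, by linarith⟩ ⟨hm.1.le, hm.2⟩
      rw [← Sobolev.val_sub_val, ← hK] at h2
      nlinarith [sq_nonneg (2 * u.val y - u.val x)]
  rw [integral_add ((L2R.integrable_sq _).integrableOn.const_mul _) (integrable_const _),
    integral_const_mul] at h1
  simp only [integral_const, measureReal_restrict_apply_univ, Real.volume_real_Ioc, smul_eq_mul,
    add_sub_cancel_left, max_eq_left hh.le] at h1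
  linarith

/-- The cells of a grid are disjoint. -/
theorem sum_setIntegral_cell_le {f : ℝ → ℝ} (hf : Integrable f) (h0 : ∀ x, 0 ≤ f x)
    (h a : ℝ) (F : Finset ℤ) :
    ∑ i ∈ F, ∫ x in Ioc (a + i * h) (a + i * h + h), f x ≤ ∫ x, f x := by
  have hd := pairwise_disjoint_Ioc_add_zsmul a h
  have e : ∀ i : ℤ, Ioc (a + i • h) (a + (i + 1) • h) = Ioc (a + i * h) (a + i * h + h) := by
    intro i
    simp only [zsmul_eq_mul]
    push_cast
    ring_nf
  simp only [e] at hd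
  rw [← integral_biUnion_finset F (fun i _ => measurableSet_Ioc) (fun i _ j _ hij => hd hij)
    fun i _ => hf.integrableOn]
  exact setIntegral_le_integral hf (Filter.Eventually.of_forall h0)

namespace Sobolev

/-- Point evaluation at `x`, a bounded linear functional on `H¹(ℝ)`. -/
noncomputable def evalL (x : ℝ) : Sobolev 1 →L[ℝ] ℝ :=
  LinearMap.mkContinuous
    { toFun := fun u => u.val x
      map_add' := fun u w => by rw [val_add]; rfl
      map_smul' := fun c u => by rw [val_smul]; rfl } 2 fun u => by
    have h1 := mul_val_sq_le u (x := x) one_pos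
    have h2 : ∀ j, ∫ y in Ioc x (x + 1), dx j u y ^ 2 ≤ ‖dx j u‖ ^ 2 := fun j => by
      rw [L2R.norm_sq_eq_integral]
      exact setIntegral_le_integral (L2R.integrable_sq _)
        (Filter.Eventually.of_forall fun x => sq_nonneg _)
    have h3 := norm_sq_eq u
    have h4 := h2 0
    have h5 := h2 1
    refine abs_le_of_sq_le_sq (a := u.val x) ?_ (by positivity)
    nlinarith [sq_nonneg ‖u‖]

@[simp]
theorem evalL_apply (x : ℝ) (u : Sobolev 1) : evalL x u = u.val x := rfl

end Sobolev

/-- The sequence `ℓ` of functionals maps `X` to the square-summable sequences on a grid of step `h`,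
with operator norm at most `√C`; finite sums are used to make summability part of the definition. -/
def IsGridBounded {X : Type*} [NormedAddCommGroup X] [NormedSpace ℝ X] (h C : ℝ)
    (ℓ : ℤ → X →L[ℝ] ℝ) : Prop :=
  ∀ (u : X) (F : Finset ℤ), ∑ i ∈ F, ℓ i u ^ 2 * h ≤ C * ‖u‖ ^ 2

theorem sum_cell_sq_le (w : L2R) (h a : ℝ) (F : Finset ℤ) :
    ∑ i ∈ F, ∫ x in Ioc (a + i * h) (a + i * h + h), w x ^ 2 ≤ ‖w‖ ^ 2 := by
  rw [L2R.norm_sq_eq_integral]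
  exact sum_setIntegral_cell_le (L2R.integrable_sq w) (fun x => sq_nonneg _) h a F

/-- Sampling is bounded from `H¹(ℝ)` to the grid. -/
theorem isGridBounded_evalL {h : ℝ} (hh : 0 < h) (a : ℝ) :
    IsGridBounded h (2 * (1 + h ^ 2)) fun i => Sobolev.evalL (a + i * h) := by
  intro u F
  calc ∑ i ∈ F, (Sobolev.evalL (a + i * h) u) ^ 2 * h
      ≤ ∑ i ∈ F, (2 * (∫ y in Ioc (a + i * h) (a + i * h + h), Sobolev.dx 0 u y ^ 2)
        + 2 * h ^ 2 * ∫ y in Ioc (a + i * h) (a + i * h + h), Sobolev.dx 1 u y ^ 2) :=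
        Finset.sum_le_sum fun i _ => Sobolev.mul_val_sq_le u hh
    _ ≤ 2 * ‖Sobolev.dx 0 u‖ ^ 2 + 2 * h ^ 2 * ‖Sobolev.dx 1 u‖ ^ 2 := by
        rw [Finset.sum_add_distrib, ← Finset.mul_sum, ← Finset.mul_sum]
        gcongr
        · exact sum_cell_sq_le _ h a F
        · exact sum_cell_sq_le _ h a F
    _ ≤ _ := by
        rw [Sobolev.norm_sq_eq]
        nlinarith [sq_nonneg ‖Sobolev.dx 0 u‖, sq_nonneg ‖Sobolev.dx 1 u‖, sq_nonneg h,
          mul_nonneg (sq_nonneg h) (sq_nonneg ‖Sobolev.dx 0 u‖)]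

namespace Sobolev

/-- The `j`-th derivative, `j ≤ 2`, as a map `H³(ℝ) → H¹(ℝ)`: the tuple `(u^(j), u^(j+1))`. -/
noncomputable def derivH (j : Fin 3) : Sobolev 3 →L[ℝ] Sobolev 1 where
  toFun u := ⟨WithLp.toLp 2 (fun l : Fin 2 => u.1 (if l = 0 then j.castSucc else j.succ)), by
    intro l
    fin_cases l
    exact u.2 j⟩
  map_add' _ _ := rfl
  map_smul' _ _ := rfl
  cont := by
    refine Continuous.subtype_mk ?_ _
    fun_prop

theorem norm_dx_le {k : ℕ} (j : Fin (k + 1)) (u : Sobolev k) : ‖dx j u‖ ≤ ‖u‖ :=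
  PiLp.norm_apply_le u.1 j

theorem val_derivH_zero (u : Sobolev 3) : (derivH 0 u).val = u.val := rfl

theorem val_inclH (u : Sobolev 3) : (inclH u).val = u.val := rfl

/-- The continuous representatives of `u, u'` and of `u', u''` are classically related. -/
theorem hasDerivAt_val_derivH (u : Sobolev 3) (j : Fin 2) (x : ℝ) :
    HasDerivAt (derivH j.castSucc u).val ((derivH j.succ u).val x) x := by
  have h : (derivH j.castSucc u).val
      = fun y => (derivH j.castSucc u).val 0 + ∫ t in (0:ℝ)..y, (derivH j.succ u).val t := by
    funext y
    have h1 := val_sub_val (derivH j.castSucc u) 0 y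
    have h2 : ∫ t in (0:ℝ)..y, dx 1 (derivH j.castSucc u) t
        = ∫ t in (0:ℝ)..y, (derivH j.succ u).val t := by
      refine intervalIntegral.integral_congr_ae ?_
      filter_upwards [dx_zero_ae_eq_val (derivH j.succ u)] with t ht _
      exact ht
    linarith
  rw [h]
  exact ((continuous_val _).integral_hasStrictDerivAt 0 x).hasDerivAt.const_add _

end Sobolev

/-! ### Consistency of the finite differences -/

namespace Sobolev

/-- The error `(u(x + h) - u(x)) / h - u'(x + θ h)` of a difference quotient. -/
noncomputable def diffDefect (h θ x : ℝ) : Sobolev 3 →L[ℝ] ℝ :=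
  h⁻¹ • ((evalL (x + h)).comp (derivH 0) - (evalL x).comp (derivH 0))
    - (evalL (x + θ * h)).comp (derivH 1)

theorem diffDefect_apply (h θ x : ℝ) (u : Sobolev 3) :
    diffDefect h θ x u = (u.val (x + h) - u.val x) / h - (derivH 1 u).val (x + θ * h) := by
  simp [diffDefect, val_derivH_zero, div_eq_inv_mul]

theorem abs_val_sub_val_le (w : Sobolev 1) {a h p q : ℝ} (hh : 0 < h) (hp : p ∈ Icc a (a + h))
    (hq : q ∈ Icc a (a + h)) :
    |w.val q - w.val p| ≤ √(h * ∫ x in Ioc a (a + h), dx 1 w x ^ 2) := by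
  refine Real.abs_le_sqrt ?_
  rw [val_sub_val]
  exact L2R.sq_integral_le _ hh hp hq

/-- The mean value inequality for `y ↦ u(y) - y u'(x + θ h)` on a cell. -/
theorem diffDefect_sq_mul_le (u : Sobolev 3) {h θ : ℝ} (hh : 0 < h) (hθ : θ ∈ Icc (0:ℝ) 1) (x : ℝ) :
    diffDefect h θ x u ^ 2 * h ≤ h ^ 2 * ∫ y in Ioc x (x + h), dx 2 u y ^ 2 := by
  set J := ∫ y in Ioc x (x + h), dx 2 u y ^ 2 with hJ
  have hJ0 : 0 ≤ J := integral_nonneg fun y => sq_nonneg _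
  have hc : x + θ * h ∈ Icc x (x + h) := by
    constructor <;> nlinarith [hθ.1, hθ.2]
  have hbound := Convex.norm_image_sub_le_of_norm_hasDerivWithin_le (s := Icc x (x + h))
    (f := fun y => u.val y - y * (derivH 1 u).val (x + θ * h))
    (f' := fun y => (derivH 1 u).val y - 1 * (derivH 1 u).val (x + θ * h)) (C := √(h * J))
    (fun y _ => ((hasDerivAt_val_derivH u 0 y).sub
      ((hasDerivAt_id y).mul_const _)).hasDerivWithinAt)
    (fun y hy => by
      rw [one_mul, Real.norm_eq_abs]
      exact abs_val_sub_val_le (derivH 1 u) hh hc hy)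
    (convex_Icc _ _) (x := x) (y := x + h) ⟨le_rfl, by linarith⟩ ⟨by linarith, le_rfl⟩
  rw [add_sub_cancel_left, Real.norm_eq_abs, Real.norm_eq_abs, abs_of_pos hh] at hbound
  have e : diffDefect h θ x u * h = u.val (x + h) - (x + h) * (derivH 1 u).val (x + θ * h)
      - (u.val x - x * (derivH 1 u).val (x + θ * h)) := by
    rw [diffDefect_apply]
    field_simp
    ring
  rw [← e] at hbound
  have h2 := sq_le_sq' (abs_le.1 hbound).1 (abs_le.1 hbound).2
  rw [mul_pow, mul_pow, Real.sq_sqrt (by positivity)] at h2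
  have h3 : diffDefect h θ x u ^ 2 ≤ h * J := le_of_mul_le_mul_right h2 (by positivity)
  nlinarith

/-- At the midpoint of the cell the second order terms of the Taylor expansions at the two ends
cancel. -/
theorem diffDefect_half_sq_mul_le (u : Sobolev 3) {h : ℝ} (hh : 0 < h) (x : ℝ) :
    diffDefect h (1 / 2) x u ^ 2 * h ≤ h ^ 4 * ∫ y in Ioc x (x + h), dx 3 u y ^ 2 := by
  set J := ∫ y in Ioc x (x + h), dx 3 u y ^ 2 with hJ
  have hJ0 : 0 ≤ J := integral_nonneg fun y => sq_nonneg _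
  set c := x + 1 / 2 * h with hcdef
  have hc : c ∈ Icc x (x + h) := by
    constructor <;> linarith
  have h1 : ∀ y ∈ Icc x (x + h),
      ‖(derivH 1 u).val y - (derivH 1 u).val c - (y - c) * (derivH 2 u).val c‖ ≤ √(h * J) * h := by
    intro y hy
    have hb := Convex.norm_image_sub_le_of_norm_hasDerivWithin_le (s := Icc x (x + h))
      (f := fun y => (derivH 1 u).val y - y * (derivH 2 u).val c)
      (f' := fun y => (derivH 2 u).val y - 1 * (derivH 2 u).val c) (C := √(h * J))
      (fun y _ => ((hasDerivAt_val_derivH u 1 y).sub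
        ((hasDerivAt_id y).mul_const _)).hasDerivWithinAt)
      (fun y hy => by
        rw [one_mul, Real.norm_eq_abs]
        exact abs_val_sub_val_le (derivH 2 u) hh hc hy)
      (convex_Icc _ _) hc hy
    have e : (derivH 1 u).val y - (derivH 1 u).val c - (y - c) * (derivH 2 u).val c
      = (derivH 1 u).val y - y * (derivH 2 u).val c
        - ((derivH 1 u).val c - c * (derivH 2 u).val c) := by ring
    rw [e]
    refine hb.trans (mul_le_mul_of_nonneg_left ?_ (Real.sqrt_nonneg _))
    rw [Real.norm_eq_abs, abs_le]
    constructor <;> linarith [hy.1, hy.2]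
  have hbound := Convex.norm_image_sub_le_of_norm_hasDerivWithin_le (s := Icc x (x + h))
    (f := fun y => u.val y - y * (derivH 1 u).val c - (y - c) ^ 2 * ((derivH 2 u).val c / 2))
    (f' := fun y => (derivH 1 u).val y - 1 * (derivH 1 u).val c
      - (2 * (y - c) ^ (2 - 1) * 1) * ((derivH 2 u).val c / 2)) (C := √(h * J) * h)
    (fun y _ => (((hasDerivAt_val_derivH u 0 y).sub ((hasDerivAt_id y).mul_const _)).sub
      ((((hasDerivAt_id y).sub_const c).pow 2).mul_const _)).hasDerivWithinAt)
    (fun y hy => by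
      refine le_trans (le_of_eq ?_) (h1 y hy)
      congr 1
      ring)
    (convex_Icc _ _) (x := x) (y := x + h) ⟨le_rfl, by linarith⟩ ⟨by linarith, le_rfl⟩
  rw [add_sub_cancel_left, Real.norm_eq_abs, Real.norm_eq_abs, abs_of_pos hh] at hbound
  have e : diffDefect h (1 / 2) x u * h
      = u.val (x + h) - (x + h) * (derivH 1 u).val c - (x + h - c) ^ 2 * ((derivH 2 u).val c / 2)
      - (u.val x - x * (derivH 1 u).val c - (x - c) ^ 2 * ((derivH 2 u).val c / 2)) := by
    rw [diffDefect_apply, ← hcdef]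
    have : (x + h - c) ^ 2 = (x - c) ^ 2 := by rw [hcdef]; ring
    rw [this]
    field_simp
    ring
  rw [← e] at hbound
  have h2 := sq_le_sq' (abs_le.1 hbound).1 (abs_le.1 hbound).2
  rw [mul_pow, mul_pow, mul_pow, Real.sq_sqrt (by positivity)] at h2
  have h3 : diffDefect h (1 / 2) x u ^ 2 ≤ h * J * h ^ 2 :=
    le_of_mul_le_mul_right h2 (by positivity)
  nlinarith

end Sobolev

/-- One-sided differences are consistent of order one. -/
theorem isGridBounded_diffDefect {h θ : ℝ} (hh : 0 < h) (hθ : θ ∈ Icc (0:ℝ) 1) (a : ℝ) :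
    IsGridBounded h (h ^ 2) fun i => Sobolev.diffDefect h θ (a + i * h) := by
  intro u F
  refine (Finset.sum_le_sum fun i _ => Sobolev.diffDefect_sq_mul_le u hh hθ _).trans ?_
  rw [← Finset.mul_sum]
  gcongr
  exact (sum_cell_sq_le _ h a F).trans (by gcongr; exact Sobolev.norm_dx_le 2 u)

/-- Centred differences are consistent of order two. -/
theorem isGridBounded_diffDefect_half {h : ℝ} (hh : 0 < h) (a : ℝ) :
    IsGridBounded h (h ^ 4) fun i => Sobolev.diffDefect h (1 / 2) (a + i * h) := by
  intro u F
  refine (Finset.sum_le_sum fun i _ => Sobolev.diffDefect_half_sq_mul_le u hh _).trans ?_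
  rw [← Finset.mul_sum]
  gcongr
  exact (sum_cell_sq_le _ h a F).trans (by gcongr; exact Sobolev.norm_dx_le 3 u)

/-! ### Velocity averages -/

theorem velAvg_eq {E : Type*} [NormedAddCommGroup E] [NormedSpace ℝ E] (φ : ℝ → E) :
    velAvg φ = (1 / 2 : ℝ) • ∫ v, φ v ∂velMeasure := by
  rw [velAvg, intervalIntegral.integral_of_le (by norm_num), ← integral_Icc_eq_integral_Ioc]

theorem ae_velMeasure_mem : ∀ᵐ v ∂velMeasure, v ∈ Icc (-1:ℝ) 1 := ae_restrict_mem measurableSet_Icc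

theorem velAvg_congr {E : Type*} [NormedAddCommGroup E] [NormedSpace ℝ E] {φ ψ : ℝ → E}
    (h : φ =ᵐ[velMeasure] ψ) : velAvg φ = velAvg ψ := by
  rw [velAvg_eq, velAvg_eq, integral_congr_ae h]

theorem velAvg_mono {φ ψ : ℝ → ℝ} (hφ : Integrable φ velMeasure) (hψ : Integrable ψ velMeasure)
    (h : φ ≤ᵐ[velMeasure] ψ) : velAvg φ ≤ velAvg ψ := by
  rw [velAvg_eq, velAvg_eq]
  exact smul_le_smul_of_nonneg_left (integral_mono_ae hφ hψ h) (by norm_num)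

theorem velAvg_nonneg {φ : ℝ → ℝ} (h : ∀ v, 0 ≤ φ v) : 0 ≤ velAvg φ := by
  rw [velAvg_eq]
  exact smul_nonneg (by norm_num) (integral_nonneg h)

theorem velAvg_add {E : Type*} [NormedAddCommGroup E] [NormedSpace ℝ E] {φ ψ : ℝ → E}
    (hφ : Integrable φ velMeasure) (hψ : Integrable ψ velMeasure) :
    velAvg (fun v => φ v + ψ v) = velAvg φ + velAvg ψ := by
  rw [velAvg_eq, velAvg_eq, velAvg_eq, integral_add hφ hψ, smul_add]

theorem velAvg_sub {E : Type*} [NormedAddCommGroup E] [NormedSpace ℝ E] {φ ψ : ℝ → E}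
    (hφ : Integrable φ velMeasure) (hψ : Integrable ψ velMeasure) :
    velAvg (fun v => φ v - ψ v) = velAvg φ - velAvg ψ := by
  rw [velAvg_eq, velAvg_eq, velAvg_eq, integral_sub hφ hψ, smul_sub]

theorem velAvg_const_mul (c : ℝ) (φ : ℝ → ℝ) :
    velAvg (fun v => c * φ v) = c * velAvg φ := by
  rw [velAvg_eq, velAvg_eq, integral_const_mul, smul_eq_mul, smul_eq_mul]
  ring

theorem velAvg_const (c : ℝ) : velAvg (fun _ => c) = c := by
  simp [velAvg]
  ring

theorem velAvg_finset_sum {ι : Type*} (F : Finset ι) {φ : ι → ℝ → ℝ}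
    (hφ : ∀ i ∈ F, Integrable (φ i) velMeasure) :
    velAvg (fun v => ∑ i ∈ F, φ i v) = ∑ i ∈ F, velAvg (φ i) := by
  simp only [velAvg_eq]
  rw [integral_finsetSum F hφ, Finset.smul_sum]

/-- Bounded linear maps commute with the velocity average. -/
theorem velAvg_clm {E F : Type*} [NormedAddCommGroup E] [NormedSpace ℝ E] [CompleteSpace E]
    [NormedAddCommGroup F] [NormedSpace ℝ F] [CompleteSpace F] (L : E →L[ℝ] F) {φ : ℝ → E}
    (hφ : Integrable φ velMeasure) :
    velAvg (fun v => L (φ v)) = L (velAvg φ) := by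
  rw [velAvg_eq, velAvg_eq, L.integral_comp_comm hφ, map_smul]

theorem integrable_of_memLp_vel {E : Type*} [NormedAddCommGroup E] {φ : ℝ → E}
    (hφ : MemLp φ 2 velMeasure) : Integrable φ velMeasure :=
  hφ.integrable one_le_two

/-- Multiplication by a function of `v` that is bounded on `[-1,1]`. -/
theorem memLp_vel_smul {E : Type*} [NormedAddCommGroup E] [NormedSpace ℝ E] {m : ℝ → ℝ} {φ : ℝ → E}
    (hm : Continuous m) (hφ : MemLp φ 2 velMeasure) : MemLp (fun v => m v • φ v) 2 velMeasure := by
  obtain ⟨C, hC⟩ := isCompact_Icc.exists_bound_of_continuousOn (s := Icc (-1:ℝ) 1) hm.continuousOn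
  refine MemLp.of_le_mul (c := C) hφ (hm.aestronglyMeasurable.smul hφ.1) ?_
  filter_upwards [ae_velMeasure_mem] with v hv
  rw [norm_smul]
  exact mul_le_mul_of_nonneg_right (hC v hv) (norm_nonneg _)

theorem memLp_vel_mul {m : ℝ → ℝ} {φ : ℝ → ℝ}
    (hm : Continuous m) (hφ : MemLp φ 2 velMeasure) : MemLp (fun v => m v * φ v) 2 velMeasure :=
  memLp_vel_smul hm hφ

theorem integrable_vel_mul {φ ψ : ℝ → ℝ} (hφ : MemLp φ 2 velMeasure) (hψ : MemLp ψ 2 velMeasure) :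
    Integrable (fun v => φ v * ψ v) velMeasure := hφ.integrable_mul hψ

/-- The functions `ψ_i(v)` satisfy `∑ ⟨ψ_i²⟩ h ≤ B`. Finite sums are used to make summability part
of the definition. -/
structure VelBound (h : ℝ) (ψ : ℤ → ℝ → ℝ) (B : ℝ) : Prop where
  memLp : ∀ i, MemLp (ψ i) 2 velMeasure
  sum_le : ∀ F : Finset ℤ, ∑ i ∈ F, velAvg (fun v => ψ i v ^ 2) * h ≤ B

theorem norm_sq_eq_integral_vel {X : Type*} [NormedAddCommGroup X] [InnerProductSpace ℝ X]
    (φ : Lp X 2 velMeasure) : ‖φ‖ ^ 2 = ∫ v, ‖φ v‖ ^ 2 ∂velMeasure := by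
  rw [← real_inner_self_eq_norm_sq, L2.inner_def]
  simp

/-- Grid-bounded functionals may be applied velocity by velocity. -/
theorem IsGridBounded.velBound {X : Type*} [NormedAddCommGroup X] [InnerProductSpace ℝ X]
    {h C : ℝ} {ℓ : ℤ → X →L[ℝ] ℝ} (hℓ : IsGridBounded h C ℓ) (φ : Lp X 2 velMeasure) :
    VelBound h (fun i v => ℓ i (φ v)) (C * ‖φ‖ ^ 2) := by
  have hm : ∀ i, MemLp (fun v => ℓ i (φ v)) 2 velMeasure := fun i =>
    (ℓ i).comp_memLp' (Lp.memLp φ)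
  refine ⟨hm, fun F => ?_⟩
  have hint : Integrable (fun v => ‖φ v‖ ^ 2) velMeasure :=
    (Lp.memLp φ).integrable_norm_pow (by simp)
  have h0 : 0 ≤ C * ‖φ‖ ^ 2 := by
    rw [norm_sq_eq_integral_vel, ← integral_const_mul]
    exact integral_nonneg fun v => by simpa using hℓ (φ v) ∅
  have h1 : ∑ i ∈ F, velAvg (fun v => ℓ i (φ v) ^ 2) * h ≤ 1 / 2 * (C * ‖φ‖ ^ 2) := by
    rw [norm_sq_eq_integral_vel, ← integral_const_mul, ← smul_eq_mul, ← velAvg_eq]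
    have e : ∑ i ∈ F, velAvg (fun v => ℓ i (φ v) ^ 2) * h
        = velAvg fun v => ∑ i ∈ F, h * ℓ i (φ v) ^ 2 := by
      rw [velAvg_finset_sum F fun i _ => (hm i).integrable_sq.const_mul _]
      exact Finset.sum_congr rfl fun i _ => by rw [velAvg_const_mul, mul_comm]
    rw [e]
    refine velAvg_mono (integrable_finsetSum F fun i _ => (hm i).integrable_sq.const_mul _)
      (hint.const_mul _) (Filter.Eventually.of_forall fun v => ?_)
    have := hℓ (φ v) F
    simpa only [mul_comm h] using this
  linarith

namespace VelBound

variable {h B B' : ℝ} {ψ χ : ℤ → ℝ → ℝ}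

theorem mono (hψ : VelBound h ψ B) (hB : B ≤ B') : VelBound h ψ B' :=
  ⟨hψ.memLp, fun F => (hψ.sum_le F).trans hB⟩

theorem congr (hψ : VelBound h ψ B) (hχ : ∀ i, ψ i =ᵐ[velMeasure] χ i) : VelBound h χ B := by
  refine ⟨fun i => (hψ.memLp i).ae_eq (hχ i), fun F => le_trans (le_of_eq ?_) (hψ.sum_le F)⟩
  refine Finset.sum_congr rfl fun i _ => ?_
  rw [velAvg_congr (φ := fun v => χ i v ^ 2) (ψ := fun v => ψ i v ^ 2)]
  filter_upwards [hχ i] with v hv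
  rw [hv]

/-- Domination by a multiple. -/
theorem of_sq_le (hh : 0 ≤ h) (hψ : VelBound h ψ B) (hχ : ∀ i, MemLp (χ i) 2 velMeasure) (c : ℝ)
    (hle : ∀ i, ∀ᵐ v ∂velMeasure, χ i v ^ 2 ≤ c * ψ i v ^ 2) (hc : 0 ≤ c) :
    VelBound h χ (c * B) := by
  refine ⟨hχ, fun F => ?_⟩
  refine le_trans ?_ (mul_le_mul_of_nonneg_left (hψ.sum_le F) hc)
  rw [Finset.mul_sum]
  refine Finset.sum_le_sum fun i _ => ?_
  rw [← mul_assoc, ← velAvg_const_mul]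
  exact mul_le_mul_of_nonneg_right (velAvg_mono (hχ i).integrable_sq
    ((hψ.memLp i).integrable_sq.const_mul c) (hle i)) hh

theorem const_mul (hh : 0 ≤ h) (hψ : VelBound h ψ B) (c : ℝ) :
    VelBound h (fun i v => c * ψ i v) (c ^ 2 * B) :=
  hψ.of_sq_le hh (fun i => (hψ.memLp i).const_mul c) _
    (fun i => Filter.Eventually.of_forall fun v => le_of_eq (by ring)) (sq_nonneg c)

/-- Multiplication by a continuous function of `v` that is bounded by `1` on `[-1,1]`. -/
theorem mul_left (hh : 0 ≤ h) (hψ : VelBound h ψ B) {m : ℝ → ℝ} (hm : Continuous m)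
    (hm1 : ∀ v ∈ Icc (-1:ℝ) 1, |m v| ≤ 1) : VelBound h (fun i v => m v * ψ i v) B := by
  rw [← one_mul B]
  refine hψ.of_sq_le hh (fun i => memLp_vel_mul hm (hψ.memLp i)) 1 (fun i => ?_) zero_le_one
  filter_upwards [ae_velMeasure_mem] with v hv
  rw [mul_pow]
  exact mul_le_mul_of_nonneg_right ((sq_le_one_iff_abs_le_one _).2 (hm1 v hv)) (sq_nonneg _)

theorem add (hh : 0 ≤ h) (hψ : VelBound h ψ B) (hχ : VelBound h χ B') :
    VelBound h (fun i v => ψ i v + χ i v) (2 * B + 2 * B') := by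
  refine ⟨fun i => (hψ.memLp i).add (hχ.memLp i), fun F => ?_⟩
  have h1 := hψ.sum_le F
  have h2 := hχ.sum_le F
  have h3 : ∑ i ∈ F, velAvg (fun v => (ψ i v + χ i v) ^ 2) * h
      ≤ ∑ i ∈ F, (2 * (velAvg (fun v => ψ i v ^ 2) * h)
        + 2 * (velAvg (fun v => χ i v ^ 2) * h)) := by
    refine Finset.sum_le_sum fun i _ => ?_
    have i1 := (hψ.memLp i).integrable_sq
    have i2 := (hχ.memLp i).integrable_sq
    have := velAvg_mono (((hψ.memLp i).add (hχ.memLp i)).integrable_sq)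
      ((i1.const_mul 2).add (i2.const_mul 2))
      (Filter.Eventually.of_forall fun v => by
        show (ψ i v + χ i v) ^ 2 ≤ 2 * ψ i v ^ 2 + 2 * χ i v ^ 2
        nlinarith [sq_nonneg (ψ i v - χ i v)])
    have e := velAvg_add (i1.const_mul 2) (i2.const_mul 2)
    rw [velAvg_const_mul, velAvg_const_mul] at e
    have h4 : velAvg (fun v => (ψ i v + χ i v) ^ 2)
      ≤ 2 * velAvg (fun v => ψ i v ^ 2) + 2 * velAvg (fun v => χ i v ^ 2) := this.trans e.le
    nlinarith [mul_le_mul_of_nonneg_right h4 hh]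
  rw [Finset.sum_add_distrib, ← Finset.mul_sum, ← Finset.mul_sum] at h3
  linarith

theorem sub (hh : 0 ≤ h) (hψ : VelBound h ψ B) (hχ : VelBound h χ B') :
    VelBound h (fun i v => ψ i v - χ i v) (2 * B + 2 * B') := by
  have := hψ.add hh (hχ.const_mul hh (-1))
  simpa [sub_eq_add_neg] using this

theorem summable (hh : 0 < h) (hψ : VelBound h ψ B) :
    Summable fun i => velAvg fun v => ψ i v ^ 2 := by
  have : Summable fun i => velAvg (fun v => ψ i v ^ 2) * h :=
    summable_of_sum_le (fun i => mul_nonneg (velAvg_nonneg fun v => sq_nonneg _) hh.le) hψ.sum_le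
  exact (summable_mul_right_iff hh.ne').1 this

theorem tsum_le (hh : 0 < h) (hψ : VelBound h ψ B) :
    ∑' i, velAvg (fun v => ψ i v ^ 2) * h ≤ B :=
  ((hψ.summable hh).mul_right h).tsum_le_of_sum_le hψ.sum_le

theorem isL2VelGrid (hh : 0 < h) (hψ : VelBound h ψ B) : IsL2VelGrid ψ :=
  ⟨hψ.memLp, hψ.summable hh⟩

end VelBound

/-- A square-summable grid function satisfies the bound given by its norm. -/
theorem IsL2VelGrid.velBound {h : ℝ} (hh : 0 ≤ h) {ψ : ℤ → ℝ → ℝ} (hψ : IsL2VelGrid ψ) :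
    VelBound h ψ (∑' i, velAvg (fun v => ψ i v ^ 2) * h) :=
  ⟨hψ.1, fun F => (hψ.2.mul_right h).sum_le_tsum F fun _ _ =>
    mul_nonneg (velAvg_nonneg fun _ => sq_nonneg _) hh⟩

/-! ### The energy estimate -/

/-- `φ` is integrable on `[-1,1]` and `⟨φ⟩ = a`. -/
def HasVelAvg (φ : ℝ → ℝ) (a : ℝ) : Prop := Integrable φ velMeasure ∧ velAvg φ = a

namespace HasVelAvg

variable {φ ψ : ℝ → ℝ} {a b : ℝ}

theorem add (hφ : HasVelAvg φ a) (hψ : HasVelAvg ψ b) : HasVelAvg (fun v => φ v + ψ v) (a + b) :=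
  ⟨hφ.1.add hψ.1, by rw [velAvg_add hφ.1 hψ.1, hφ.2, hψ.2]⟩

theorem sub (hφ : HasVelAvg φ a) (hψ : HasVelAvg ψ b) : HasVelAvg (fun v => φ v - ψ v) (a - b) :=
  ⟨hφ.1.sub hψ.1, by rw [velAvg_sub hφ.1 hψ.1, hφ.2, hψ.2]⟩

theorem const_mul (hφ : HasVelAvg φ a) (c : ℝ) : HasVelAvg (fun v => c * φ v) (c * a) :=
  ⟨hφ.1.const_mul c, by rw [velAvg_const_mul, hφ.2]⟩

theorem le (hφ : HasVelAvg φ a) (hψ : HasVelAvg ψ b) (h : ∀ v ∈ Icc (-1:ℝ) 1, φ v ≤ ψ v) :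
    a ≤ b := by
  rw [← hφ.2, ← hψ.2]
  exact velAvg_mono hφ.1 hψ.1 (ae_velMeasure_mem.mono h)

end HasVelAvg

theorem hasVelAvg_of_integrable {φ : ℝ → ℝ} (h : Integrable φ velMeasure) :
    HasVelAvg φ (velAvg φ) := ⟨h, rfl⟩

theorem velAvg_abs : velAvg (fun v => |v|) = 1 / 2 := by
  have h1 : ∫ v in (-1:ℝ)..0, |v| = 1 / 2 := by
    rw [intervalIntegral.integral_congr (g := fun v => -v) fun v hv => ?_]
    · rw [intervalIntegral.integral_neg, integral_id]; norm_num
    · rw [uIcc_of_le (by norm_num)] at hv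
      exact abs_of_nonpos hv.2
  have h2 : ∫ v in (0:ℝ)..1, |v| = 1 / 2 := by
    rw [intervalIntegral.integral_congr (g := fun v => v) fun v hv => ?_]
    · rw [integral_id]; norm_num
    · rw [uIcc_of_le (by norm_num)] at hv
      exact abs_of_nonneg hv.1
  rw [velAvg, ← intervalIntegral.integral_add_adjacent_intervals (b := 0)
    (continuous_abs.intervalIntegrable _ _) (continuous_abs.intervalIntegrable _ _), h1, h2]
  norm_num

theorem integrable_vel_of_continuous {m : ℝ → ℝ} (hm : Continuous m) : Integrable m velMeasure :=
  hm.integrableOn_Icc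

/-- The Cauchy-Schwarz inequality with weight `|v|`, for which `⟨|v|⟩ = 1/2`. -/
theorem velAvg_mul_sq_le {D : ℝ → ℝ} (hD : MemLp D 2 velMeasure) :
    velAvg (fun v => v * D v) ^ 2 ≤ 1 / 2 * velAvg (fun v => |v| * D v ^ 2) := by
  set s := velAvg (fun v => v * D v)
  have i1 := hasVelAvg_of_integrable (memLp_vel_mul continuous_id hD |> integrable_of_memLp_vel)
  have i2 : HasVelAvg (fun v => |v|) (1 / 2) :=
    ⟨integrable_vel_of_continuous continuous_abs, velAvg_abs⟩
  have i3 : HasVelAvg (fun v => |v| * D v ^ 2) _ := hasVelAvg_of_integrable (by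
    have := integrable_vel_mul (memLp_vel_mul continuous_abs hD) hD
    refine this.congr (Filter.Eventually.of_forall fun v => ?_)
    simp only; ring)
  have := (i1.const_mul (4 * s)).le (i3.add (i2.const_mul (4 * s ^ 2))) fun v _ => by
    -- This is `|v| (D - 2 s sign v)² ≥ 0`.
    rcases abs_cases v with ⟨h1, h2⟩ | ⟨h1, h2⟩ <;> rw [h1] <;> simp only [id]
    · nlinarith [mul_nonneg h2 (sq_nonneg (D v - 2 * s))]
    · nlinarith [mul_nonneg (neg_nonneg.2 h2.le) (sq_nonneg (D v + 2 * s))]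
  have e : velAvg (fun v => id v * D v) = s := rfl
  rw [e] at this
  nlinarith

/-- The flux through which the upwind part of the energy balance telescopes; `g₀, G₀` are the values
in the cell on the left of the interface and `g₁, G₁` those on its right. -/
noncomputable def energyFlux (a b v g₀ g₁ G₀ G₁ : ℝ) : ℝ :=
  a * ((v + |v|) / 2 * (2 * g₀ * G₁ - G₁ ^ 2) + (v - |v|) / 2 * (2 * g₁ * G₀ - G₀ ^ 2))
    + (a * ((v - |v|) / 2) + b * ((v - |v|) / 2) ^ 2) * (G₁ - G₀) ^ 2

/-- The upwind energy balance at one cell and one velocity, with `a = Δt / Δx`, and with `g` and `G`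
the values before and after the time step. -/
theorem local_energy_inequality {ε a v g₀ g₁ g₂ G₀ G₁ G₂ : ℝ} (hv : v ∈ Icc (-1:ℝ) 1) :
    ε ^ 2 * (G₁ ^ 2 - g₁ ^ 2) + (ε * a - a ^ 2) * (|v| * (G₂ - G₁) ^ 2)
      + (energyFlux (ε * a) (a ^ 2) v g₁ g₂ G₁ G₂ - energyFlux (ε * a) (a ^ 2) v g₀ g₁ G₀ G₁)
    ≤ 2 * ((ε ^ 2 * (G₁ - g₁)
      + ε * a * ((v + |v|) / 2 * (g₁ - g₀) + (v - |v|) / 2 * (g₂ - g₁))) * G₁) := by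
  unfold energyFlux
  -- For each sign of `v` a single one-sided difference is left; the mixed term is absorbed by
  -- completing the square with `ε² (G₁ - g₁)²`, at the cost of `a² v² ≤ a² |v|`.
  rcases abs_cases v with ⟨h1, h2⟩ | ⟨h1, h2⟩ <;> rw [h1]
  · have h3 : 0 ≤ v * (1 - v) * (a * (G₂ - G₁)) ^ 2 := by
      have := hv.2
      have : 0 ≤ v * (1 - v) := mul_nonneg h2 (by linarith)
      positivity
    nlinarith [sq_nonneg (ε * (G₁ - g₁) + a * v * (G₂ - G₁))]
  · have h3 : 0 ≤ -v * (1 + v) * (a * (G₂ - G₁)) ^ 2 := by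
      have := hv.1
      have : 0 ≤ -v * (1 + v) := mul_nonneg (by linarith) (by linarith)
      positivity
    nlinarith [sq_nonneg (ε * (G₁ - g₁) + a * v * (G₁ - G₀))]

theorem tsum_le_tsum_of_telescoping {X Y F : ℤ → ℝ} (hX : Summable X) (hY : Summable Y)
    (hF : Summable F) (h : ∀ i, X i ≤ Y i + (F (i + 1) - F i)) : ∑' i, X i ≤ ∑' i, Y i := by
  have hF' : Summable fun i => F (i + 1) := (Equiv.addRight (1:ℤ)).summable_iff.2 hF
  have e : ∑' i, F (i + 1) = ∑' i, F i := (Equiv.addRight (1:ℤ)).tsum_eq F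
  calc ∑' i, X i ≤ ∑' i, (Y i + (F (i + 1) - F i)) :=
        hX.tsum_le_tsum h (hY.add (hF'.sub hF))
    _ = ∑' i, Y i := by rw [hY.tsum_add (hF'.sub hF), hF'.tsum_sub hF, e]; ring

theorem abs_energyFlux_le {a b v g₀ g₁ G₀ G₁ : ℝ} (ha : 0 ≤ a) (hb : 0 ≤ b)
    (hv : v ∈ Icc (-1:ℝ) 1) :
    |energyFlux a b v g₀ g₁ G₀ G₁| ≤ (4 * a + 2 * b) * (g₀ ^ 2 + g₁ ^ 2 + G₀ ^ 2 + G₁ ^ 2) := by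
  set S := g₀ ^ 2 + g₁ ^ 2 + G₀ ^ 2 + G₁ ^ 2 with hS
  have hS0 : 0 ≤ S := by positivity
  have hX : |2 * g₀ * G₁ - G₁ ^ 2| ≤ 2 * S := by
    rw [abs_le]
    constructor <;> nlinarith [sq_nonneg (g₀ - G₁), sq_nonneg (g₀ + G₁), sq_nonneg g₁, sq_nonneg G₀,
      sq_nonneg g₀]
  have hY : |2 * g₁ * G₀ - G₀ ^ 2| ≤ 2 * S := by
    rw [abs_le]
    constructor <;> nlinarith [sq_nonneg (g₁ - G₀), sq_nonneg (g₁ + G₀), sq_nonneg g₀, sq_nonneg G₁,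
      sq_nonneg g₁]
  have hZ : |(G₁ - G₀) ^ 2| ≤ 2 * S := by
    rw [abs_of_nonneg (sq_nonneg _)]
    nlinarith [sq_nonneg (G₁ + G₀), sq_nonneg g₀, sq_nonneg g₁]
  have hv1 : |v| ≤ 1 := abs_le.2 hv
  have key : ∀ m X : ℝ, ∀ c, |m| ≤ c → |X| ≤ 2 * S → |m * X| ≤ c * (2 * S) := fun m X c hm hx => by
    rw [abs_mul]
    exact mul_le_mul hm hx (abs_nonneg _) ((abs_nonneg _).trans hm)
  have hav : |a * v| ≤ a := by
    rw [abs_mul, abs_of_nonneg ha]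
    exact mul_le_of_le_one_right ha hv1
  have hbv : |b * v ^ 2| ≤ b := by
    rw [abs_mul, abs_of_nonneg hb, abs_of_nonneg (sq_nonneg v)]
    exact mul_le_of_le_one_right hb ((sq_le_one_iff_abs_le_one v).2 hv1)
  unfold energyFlux
  rcases abs_cases v with ⟨h1, h2⟩ | ⟨h1, h2⟩
  · rw [h1]
    have e : a * ((v + v) / 2 * (2 * g₀ * G₁ - G₁ ^ 2) + (v - v) / 2 * (2 * g₁ * G₀ - G₀ ^ 2))
      + (a * ((v - v) / 2) + b * ((v - v) / 2) ^ 2) * (G₁ - G₀) ^ 2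
      = (a * v) * (2 * g₀ * G₁ - G₁ ^ 2) := by ring
    rw [e]
    have := key _ _ _ hav hX
    nlinarith [mul_nonneg ha hS0, mul_nonneg hb hS0]
  · rw [h1]
    have e : a * ((v + -v) / 2 * (2 * g₀ * G₁ - G₁ ^ 2) + (v - -v) / 2 * (2 * g₁ * G₀ - G₀ ^ 2))
      + (a * ((v - -v) / 2) + b * ((v - -v) / 2) ^ 2) * (G₁ - G₀) ^ 2
      = (a * v) * (2 * g₁ * G₀ - G₀ ^ 2) + (a * v + b * v ^ 2) * (G₁ - G₀) ^ 2 := by ring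
    rw [e]
    have h3 := key _ _ _ hav hY
    have h4 := key _ _ _ ((abs_add_le (a * v) (b * v ^ 2)).trans (add_le_add hav hbv)) hZ
    refine (abs_add_le _ _).trans ?_
    linarith

theorem summable_shift {f : ℤ → ℝ} (hf : Summable f) (l : ℤ) : Summable fun i => f (i + l) :=
  (Equiv.addRight l).summable_iff.2 hf

theorem IsL2VelGrid.shift {ψ : ℤ → ℝ → ℝ} (hψ : IsL2VelGrid ψ) (l : ℤ) :
    IsL2VelGrid fun i v => ψ (i + l) v :=
  ⟨fun _ => hψ.1 _, summable_shift hψ.2 l⟩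

theorem IsL2VelGrid.sub {ψ χ : ℤ → ℝ → ℝ} (hψ : IsL2VelGrid ψ) (hχ : IsL2VelGrid χ) :
    IsL2VelGrid fun i v => ψ i v - χ i v :=
  ((hψ.velBound zero_le_one).sub zero_le_one (hχ.velBound zero_le_one)).isL2VelGrid one_pos

theorem integrable_abs_mul_sq {D : ℝ → ℝ} (hD : MemLp D 2 velMeasure) :
    Integrable (fun v => |v| * D v ^ 2) velMeasure := by
  refine (integrable_vel_mul (memLp_vel_mul continuous_abs hD) hD).congr
    (Filter.Eventually.of_forall fun v => ?_)
  simp only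
  ring

theorem integrable_energyFlux {a b : ℝ} (ha : 0 ≤ a) (hb : 0 ≤ b) {g₀ g₁ G₀ G₁ : ℝ → ℝ}
    (h1 : MemLp g₀ 2 velMeasure) (h2 : MemLp g₁ 2 velMeasure) (h3 : MemLp G₀ 2 velMeasure)
    (h4 : MemLp G₁ 2 velMeasure) :
    Integrable (fun v => energyFlux a b v (g₀ v) (g₁ v) (G₀ v) (G₁ v)) velMeasure := by
  refine Integrable.mono' (g := fun v => (4 * a + 2 * b) *
    (g₀ v ^ 2 + g₁ v ^ 2 + G₀ v ^ 2 + G₁ v ^ 2)) ?_ ?_ ?_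
  · exact ((((h1.integrable_sq).add h2.integrable_sq).add h3.integrable_sq).add
      h4.integrable_sq).const_mul _
  · have m1 := h1.1
    have m2 := h2.1
    have m3 := h3.1
    have m4 := h4.1
    unfold energyFlux
    fun_prop
  · exact ae_velMeasure_mem.mono fun v hv => abs_energyFlux_le ha hb hv

theorem summable_energyFlux {a b : ℝ} (ha : 0 ≤ a) (hb : 0 ≤ b) {g G : ℤ → ℝ → ℝ}
    (hg : IsL2VelGrid g) (hG : IsL2VelGrid G) :
    Summable fun i =>
      velAvg fun v => energyFlux a b v (g (i - 1) v) (g i v) (G (i - 1) v) (G i v) := by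
  have s : Summable fun i => (4 * a + 2 * b) * (velAvg (fun v => g (i - 1) v ^ 2)
      + velAvg (fun v => g i v ^ 2) + velAvg (fun v => G (i - 1) v ^ 2)
      + velAvg (fun v => G i v ^ 2)) :=
    ((((summable_shift hg.2 (-1)).add hg.2).add (summable_shift hG.2 (-1))).add hG.2).mul_left _
  refine Summable.of_norm_bounded s fun i => ?_
  have A := ((((hasVelAvg_of_integrable (hg.1 (i - 1)).integrable_sq).add
    (hasVelAvg_of_integrable (hg.1 i).integrable_sq)).add
    (hasVelAvg_of_integrable (hG.1 (i - 1)).integrable_sq)).add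
    (hasVelAvg_of_integrable (hG.1 i).integrable_sq)).const_mul (4 * a + 2 * b)
  have B := hasVelAvg_of_integrable
    (integrable_energyFlux ha hb (hg.1 (i - 1)) (hg.1 i) (hG.1 (i - 1)) (hG.1 i))
  rw [Real.norm_eq_abs, abs_le]
  constructor
  · have := (A.const_mul (-1)).le B fun v hv => by
      have := (abs_le.1 (abs_energyFlux_le ha hb hv (g₀ := g (i - 1) v) (g₁ := g i v)
        (G₀ := G (i - 1) v) (G₁ := G i v))).1
      linarith
    linarith
  · exact B.le A fun v hv => (abs_le.1 (abs_energyFlux_le ha hb hv)).2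

theorem summable_sq_add {x y : ℤ → ℝ} (hx : Summable fun i => x i ^ 2)
    (hy : Summable fun i => y i ^ 2) : Summable fun i => (x i + y i) ^ 2 :=
  Summable.of_nonneg_of_le (fun _ => sq_nonneg _) (fun _ => add_sq_le)
    ((hx.add hy).mul_left 2)

theorem summable_sq_const_mul {x : ℤ → ℝ} (hx : Summable fun i => x i ^ 2) (c : ℝ) :
    Summable fun i => (c * x i) ^ 2 := by
  simpa only [mul_pow] using hx.mul_left (c ^ 2)

theorem summable_sq_sub {x y : ℤ → ℝ} (hx : Summable fun i => x i ^ 2)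
    (hy : Summable fun i => y i ^ 2) : Summable fun i => (x i - y i) ^ 2 := by
  simpa [sub_eq_add_neg] using summable_sq_add hx (summable_sq_const_mul hy (-1))

theorem summable_mul_of_summable_sq {x y : ℤ → ℝ} (hx : Summable fun i => x i ^ 2)
    (hy : Summable fun i => y i ^ 2) : Summable fun i => x i * y i := by
  refine Summable.of_norm_bounded (hx.add hy) fun i => ?_
  rw [Real.norm_eq_abs, abs_le]
  constructor <;> nlinarith [sq_nonneg (x i + y i), sq_nonneg (x i - y i)]

theorem velAvg_abs_mul_sq_le {D : ℝ → ℝ} (hD : MemLp D 2 velMeasure) :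
    velAvg (fun v => |v| * D v ^ 2) ≤ velAvg fun v => D v ^ 2 :=
  (hasVelAvg_of_integrable (integrable_abs_mul_sq hD)).le
    (hasVelAvg_of_integrable hD.integrable_sq) fun _ hv =>
      mul_le_of_le_one_left (sq_nonneg _) (abs_le.2 hv)

theorem summable_velAvg_mul_sq {G : ℤ → ℝ → ℝ} (hG : IsL2VelGrid G) :
    Summable fun i => velAvg (fun v => v * G i v) ^ 2 :=
  Summable.of_nonneg_of_le (fun _ => sq_nonneg _) (fun i => (velAvg_mul_sq_le (hG.1 i)).trans
    (mul_le_mul_of_nonneg_left (velAvg_abs_mul_sq_le (hG.1 i)) (by norm_num))) (hG.2.mul_left _)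

/-- The divergence `(⟨v G_{i+1/2}⟩ - ⟨v G_{i-1/2}⟩) / h` of the flux. -/
theorem velAvg_mul_diff {G : ℤ → ℝ → ℝ} (hG : ∀ i, MemLp (G i) 2 velMeasure) (h : ℝ) (i : ℤ) :
    velAvg (fun v => v * ((G i v - G (i - 1) v) / h))
      = (velAvg (fun v => v * G i v) - velAvg (fun v => v * G (i - 1) v)) / h := by
  have a : ∀ i, HasVelAvg (fun v => v * G i v) _ := fun i =>
    hasVelAvg_of_integrable (memLp_vel_mul continuous_id (hG i) |> integrable_of_memLp_vel)
  have := (((a i).sub (a (i - 1))).const_mul h⁻¹).2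
  rw [div_eq_inv_mul]
  rw [← this]
  congr 1
  funext v
  rw [div_eq_inv_mul]
  ring

theorem memLp_upwind {g : ℤ → ℝ → ℝ} (hg : ∀ i, MemLp (g i) 2 velMeasure) (i : ℤ) :
    MemLp (upwind g i) 2 velMeasure := by
  have h1 := memLp_vel_mul (m := fun v => (v + |v|) / 2) (by fun_prop) ((hg i).sub (hg (i - 1)))
  have h2 := memLp_vel_mul (m := fun v => (v - |v|) / 2) (by fun_prop) ((hg (i + 1)).sub (hg i))
  exact h1.add h2

section step

variable {σ ε k h : ℝ} {ρ : ℤ → ℝ} {g G τ : ℤ → ℝ → ℝ}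

/-- The energy balance of one cell. -/
theorem cell_energy_inequality (hσ : 0 < σ) (hε : 0 < ε) (hk : 0 < k) (hh : 0 < h)
    (hg : IsL2VelGrid g) (hG : IsL2VelGrid G) (hτ : IsL2VelGrid τ)
    (micro : ∀ i, velAvg (fun v => (ε ^ 2 * (G i v - g i v)
      + k * (ε / h * upwind g i v + σ * G i v + v * ((ρ (i + 1) - ρ i) / h) - τ i v)) * G i v) = 0)
    (i : ℤ) :
    ε ^ 2 * (velAvg (fun v => G i v ^ 2) - velAvg (fun v => g i v ^ 2))
      + (ε * (k / h) - (k / h) ^ 2) * velAvg (fun v => |v| * (G (i + 1) v - G i v) ^ 2)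
      + (velAvg (fun v => energyFlux (ε * (k / h)) ((k / h) ^ 2) v (g i v) (g (i + 1) v) (G i v)
          (G (i + 1) v))
        - velAvg (fun v => energyFlux (ε * (k / h)) ((k / h) ^ 2) v (g (i - 1) v) (g i v)
          (G (i - 1) v) (G i v)))
      + k * σ * velAvg (fun v => G i v ^ 2) - k / σ * velAvg (fun v => τ i v ^ 2)
      + 2 * (k / h) * (ρ (i + 1) - ρ i) * velAvg (fun v => v * G i v) ≤ 0 := by
  have ha : 0 ≤ ε * (k / h) := by positivity
  have hb : 0 ≤ (k / h) ^ 2 := by positivity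
  have iG := hasVelAvg_of_integrable (hG.1 i).integrable_sq
  have ig := hasVelAvg_of_integrable (hg.1 i).integrable_sq
  have iτ := hasVelAvg_of_integrable (hτ.1 i).integrable_sq
  have iD := hasVelAvg_of_integrable (integrable_abs_mul_sq ((hG.1 (i + 1)).sub (hG.1 i)))
  have iF0 := hasVelAvg_of_integrable
    (integrable_energyFlux ha hb (hg.1 i) (hg.1 (i + 1)) (hG.1 i) (hG.1 (i + 1)))
  have iF1 := hasVelAvg_of_integrable
    (integrable_energyFlux ha hb (hg.1 (i - 1)) (hg.1 i) (hG.1 (i - 1)) (hG.1 i))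
  have iv := hasVelAvg_of_integrable
    (integrable_of_memLp_vel (memLp_vel_mul continuous_id (hG.1 i)))
  have mP : MemLp (fun v => ε ^ 2 * (G i v - g i v)
      + k * (ε / h * upwind g i v + σ * G i v + v * ((ρ (i + 1) - ρ i) / h) - τ i v))
      2 velMeasure := by
    have m1 : MemLp (fun v : ℝ => v * ((ρ (i + 1) - ρ i) / h)) 2 velMeasure :=
      memLp_vel_mul continuous_id (memLp_const _)
    exact (((hG.1 i).sub (hg.1 i)).const_mul _).add (((((memLp_upwind hg.1 i).const_mul _).add
      ((hG.1 i).const_mul _)).add m1).sub (hτ.1 i) |>.const_mul k)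
  have iP : HasVelAvg _ 0 := ⟨integrable_vel_mul mP (hG.1 i), micro i⟩
  have := ((((((iG.sub ig).const_mul (ε ^ 2)).add
    (iD.const_mul (ε * (k / h) - (k / h) ^ 2))).add (iF0.sub iF1)).add
    (iG.const_mul (k * σ))).sub (iτ.const_mul (k / σ))).add
    (iv.const_mul (2 * (k / h) * (ρ (i + 1) - ρ i))) |>.le (iP.const_mul 2) fun v hv => by
      have h1 := local_energy_inequality (ε := ε) (a := k / h) (g₀ := g (i - 1) v) (g₁ := g i v)
        (g₂ := g (i + 1) v) (G₀ := G (i - 1) v) (G₁ := G i v) (G₂ := G (i + 1) v) hv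
      have h2 : 2 * k * (τ i v * G i v) ≤ k * σ * G i v ^ 2 + k / σ * τ i v ^ 2 := by
        have e : k * σ * G i v ^ 2 + k / σ * τ i v ^ 2 - 2 * k * (τ i v * G i v)
          = k / σ * (σ * G i v - τ i v) ^ 2 := by
          field_simp
          ring
        have : 0 ≤ k / σ * (σ * G i v - τ i v) ^ 2 := by positivity
        linarith
      have e : 2 * ((ε ^ 2 * (G i v - g i v) + k * (ε / h * upwind g i v + σ * G i v
          + v * ((ρ (i + 1) - ρ i) / h) - τ i v)) * G i v)
        = 2 * ((ε ^ 2 * (G i v - g i v) + ε * (k / h) * ((v + |v|) / 2 * (g i v - g (i - 1) v)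
          + (v - |v|) / 2 * (g (i + 1) v - g i v))) * G i v) + 2 * k * σ * G i v ^ 2
          - 2 * k * (τ i v * G i v) + 2 * (k / h) * (ρ (i + 1) - ρ i) * (v * G i v) := by
        unfold upwind
        ring
      rw [e]
      simp only [id, Pi.sub_apply]
      linarith
  simp only [id, mul_zero, Pi.sub_apply] at this
  exact this

/-- One step of the scheme with a residual `τ` in the micro equation: under the CFL condition the
numerical dissipation and half of the collisional dissipation absorb the explicit terms, so that the
residual is not divided by `ε`. -/
theorem energy_step (hσ : 0 < σ) (hε : 0 < ε) (hk : 0 < k) (hh : 0 < h)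
    (hCFL : k ≤ h ^ 2 * σ / 6 + 2 / 3 * ε * h)
    (hρ : Summable fun i => ρ i ^ 2)
    (hg : IsL2VelGrid g) (hG : IsL2VelGrid G) (hτ : IsL2VelGrid τ)
    (micro : ∀ i, velAvg (fun v => (ε ^ 2 * (G i v - g i v)
      + k * (ε / h * upwind g i v + σ * G i v + v * ((ρ (i + 1) - ρ i) / h) - τ i v)) * G i v) = 0)
    {R : ℤ → ℝ} (hR : ∀ i, R i = ρ i - k * velAvg (fun v => v * ((G i v - G (i - 1) v) / h))) :
    Summable (fun i => R i ^ 2) ∧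
    ∑' i, R i ^ 2 + ε ^ 2 * ∑' i, velAvg (fun v => G i v ^ 2)
      ≤ ∑' i, ρ i ^ 2 + ε ^ 2 * ∑' i, velAvg (fun v => g i v ^ 2)
        + k / σ * ∑' i, velAvg (fun v => τ i v ^ 2) := by
  set a : ℤ → ℝ := fun i => velAvg fun v => v * G i v with ha
  set b : ℤ → ℝ := fun i => velAvg fun v => |v| * (G (i + 1) v - G i v) ^ 2 with hb
  set γ : ℤ → ℝ := fun i => velAvg fun v => G i v ^ 2 with hγ
  set Φ : ℤ → ℝ := fun i => velAvg fun v => energyFlux (ε * (k / h)) ((k / h) ^ 2) v (g (i - 1) v)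
    (g i v) (G (i - 1) v) (G i v) with hΦ
  have hR' : ∀ i, R i = ρ i - k / h * (a i - a (i - 1)) := fun i => by
    rw [hR, velAvg_mul_diff hG.1]
    ring
  have sa : Summable fun i => a i ^ 2 := summable_velAvg_mul_sq hG
  have sa' : Summable fun i => a (i - 1) ^ 2 := summable_shift sa (-1)
  have sR : Summable fun i => R i ^ 2 := by
    simp only [hR']
    exact summable_sq_sub hρ (summable_sq_const_mul (summable_sq_sub sa sa') _)
  have hD : IsL2VelGrid fun i v => G (i + 1) v - G i v := (hG.shift 1).sub hG
  have sb : Summable b := Summable.of_nonneg_of_le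
    (fun i => velAvg_nonneg fun v => mul_nonneg (abs_nonneg v) (sq_nonneg _))
    (fun i => velAvg_abs_mul_sq_le (hD.1 i)) hD.2
  have sΦ : Summable Φ := summable_energyFlux (by positivity) (by positivity) hg hG
  have hbγ : ∀ i, b i ≤ 2 * γ (i + 1) + 2 * γ i := fun i => by
    refine (velAvg_abs_mul_sq_le (hD.1 i)).trans ?_
    exact (hasVelAvg_of_integrable (hD.1 i).integrable_sq).le
      (((hasVelAvg_of_integrable (hG.1 (i + 1)).integrable_sq).const_mul 2).add
        ((hasVelAvg_of_integrable (hG.1 i).integrable_sq).const_mul 2)) fun v _ => by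
          nlinarith [sq_nonneg (G (i + 1) v + G i v)]
  have hb0 : ∀ i, 0 ≤ b i := fun i => velAvg_nonneg fun v => mul_nonneg (abs_nonneg v) (sq_nonneg _)
  have hab : ∀ i, (a i - a (i - 1)) ^ 2 ≤ 1 / 2 * b (i - 1) := fun i => by
    have h1 := velAvg_mul_sq_le ((hG.1 i).sub (hG.1 (i - 1)))
    have h2 := velAvg_mul_diff hG.1 1 i
    simp only [div_one] at h2
    simp only [Pi.sub_apply] at h1
    rw [h2] at h1
    simpa only [hb, ha, sub_add_cancel] using h1
  refine ⟨sR, ?_⟩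
  -- This is where the CFL condition enters; `b ≤ 4 γ` up to telescoping terms, so that the bound
  -- costs one half of the collisional dissipation `2 k σ γ`.
  have hcoef : 3 / 2 * (k / h) ^ 2 - ε * (k / h) ≤ k * σ / 4 := by
    have h1 : 3 / 2 * (k / h) ^ 2 - ε * (k / h) = 3 / 2 * (k / h ^ 2) * (k - 2 / 3 * ε * h) := by
      field_simp
    have h2 : 3 / 2 * (k / h ^ 2) * (k - 2 / 3 * ε * h) ≤ 3 / 2 * (k / h ^ 2) * (h ^ 2 * σ / 6) :=
      mul_le_mul_of_nonneg_left (by linarith) (by positivity)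
    have h3 : 3 / 2 * (k / h ^ 2) * (h ^ 2 * σ / 6) = k * σ / 4 := by
      field_simp
      ring
    linarith
  rw [← tsum_mul_left, ← tsum_mul_left, ← tsum_mul_left,
    ← sR.tsum_add (hG.2.mul_left _), ← hρ.tsum_add (hg.2.mul_left _),
    ← (hρ.add (hg.2.mul_left _)).tsum_add (hτ.2.mul_left _)]
  refine tsum_le_tsum_of_telescoping
    (F := fun i => -Φ i - 2 * (k / h) * (ρ i * a (i - 1)) - 1 / 2 * (k / h) ^ 2 * b (i - 1)
      + k * σ / 2 * γ i)
    (sR.add (hG.2.mul_left _)) ((hρ.add (hg.2.mul_left _)).add (hτ.2.mul_left _))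
    (((sΦ.neg.sub ((summable_mul_of_summable_sq hρ sa').mul_left _)).sub
      ((summable_shift sb (-1)).mul_left _)).add (hG.2.mul_left _)) fun i => ?_
  have cell := cell_energy_inequality hσ hε hk hh hg hG hτ micro i
  have eΦ : Φ (i + 1) = velAvg (fun v => energyFlux (ε * (k / h)) ((k / h) ^ 2) v (g i v)
      (g (i + 1) v) (G i v) (G (i + 1) v)) := by
    simp only [hΦ, add_sub_cancel_right]
  rw [← eΦ] at cell
  change ε ^ 2 * (γ i - _) + (ε * (k / h) - (k / h) ^ 2) * b i + (Φ (i + 1) - Φ i)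
    + k * σ * γ i - _ + 2 * (k / h) * (ρ (i + 1) - ρ i) * a i ≤ 0 at cell
  simp only [add_sub_cancel_right]
  rw [hR' i]
  have h1 := mul_le_mul_of_nonneg_left (hab i) (sq_nonneg (k / h))
  have h2 := mul_le_mul_of_nonneg_right hcoef (hb0 i)
  have h3 := mul_le_mul_of_nonneg_left (hbγ i) (by positivity : 0 ≤ k * σ / 4)
  change (ρ i - k / h * (a i - a (i - 1))) ^ 2 + ε ^ 2 * γ i ≤ _
  nlinarith

end step

/-! ### Stability of the perturbed scheme -/

/-- One time step of the scheme with residuals `e` and `τ`. The micro equation is required only up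
to a constant in `v`: such a constant is orthogonal to functions of zero average. -/
structure IsPerturbedStep (σ ε k h : ℝ) (ρ ρ' : ℤ → ℝ) (g g' : ℤ → ℝ → ℝ) (e : ℤ → ℝ)
    (τ : ℤ → ℝ → ℝ) : Prop where
  macro_eq : ∀ i, ρ' i = ρ i - k * velAvg (fun v => v * ((g' i v - g' (i - 1) v) / h)) + k * e i
  micro_eq : ∀ i, ∃ c : ℝ, ∀ᵐ v ∂velMeasure, ε ^ 2 * (g' i v - g i v)
    + k * (ε / h * upwind g i v + σ * g' i v + v * ((ρ (i + 1) - ρ i) / h) - τ i v) = c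
  avg_zero : ∀ i, velAvg (g' i) = 0

/-- The energy `‖ρ‖² + ε² |||g|||²`. -/
noncomputable def energy (ε h : ℝ) (ρ : ℤ → ℝ) (g : ℤ → ℝ → ℝ) : ℝ :=
  ∑' i, ρ i ^ 2 * h + ε ^ 2 * ∑' i, velAvg (fun v => g i v ^ 2) * h

theorem energy_nonneg {ε h : ℝ} (hh : 0 ≤ h) (ρ : ℤ → ℝ) (g : ℤ → ℝ → ℝ) : 0 ≤ energy ε h ρ g :=
  add_nonneg (tsum_nonneg fun _ => mul_nonneg (sq_nonneg _) hh)
    (mul_nonneg (sq_nonneg _) (tsum_nonneg fun _ =>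
      mul_nonneg (velAvg_nonneg fun _ => sq_nonneg _) hh))

theorem gridNorm_add_velGridNorm_le {ε h : ℝ} (hε : 0 ≤ ε) (hh : 0 ≤ h) (ρ : ℤ → ℝ)
    (g : ℤ → ℝ → ℝ) : gridNorm h ρ + ε * velGridNorm h g ≤ 2 * √(energy ε h ρ g) := by
  have h1 : 0 ≤ ∑' i, ρ i ^ 2 * h := tsum_nonneg fun _ => mul_nonneg (sq_nonneg _) hh
  have h2 : 0 ≤ ∑' i, velAvg (fun v => g i v ^ 2) * h :=
    tsum_nonneg fun _ => mul_nonneg (velAvg_nonneg fun _ => sq_nonneg _) hh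
  have h3 : gridNorm h ρ ≤ √(energy ε h ρ g) :=
    Real.sqrt_le_sqrt (le_add_of_nonneg_right (mul_nonneg (sq_nonneg _) h2))
  have h4 : ε * velGridNorm h g ≤ √(energy ε h ρ g) := by
    have e : ε * velGridNorm h g = √(ε ^ 2 * ∑' i, velAvg (fun v => g i v ^ 2) * h) := by
      rw [Real.sqrt_mul (sq_nonneg _), Real.sqrt_sq hε]
      rfl
    rw [e]
    exact Real.sqrt_le_sqrt (le_add_of_nonneg_left h1)
  linarith

theorem velAvg_mul_eq_zero_of_ae_eq_const {φ G : ℝ → ℝ} {c : ℝ} (h : ∀ᵐ v ∂velMeasure, φ v = c)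
    (hG : velAvg G = 0) : velAvg (fun v => φ v * G v) = 0 := by
  rw [velAvg_congr (ψ := fun v => c * G v) (h.mono fun v hv => by simp only [hv]),
    velAvg_const_mul, hG, mul_zero]

theorem IsPerturbedStep.energy_le {σ ε k h A B : ℝ} {ρ ρ' e : ℤ → ℝ} {g g' τ : ℤ → ℝ → ℝ}
    (hstep : IsPerturbedStep σ ε k h ρ ρ' g g' e τ)
    (hσ : 0 < σ) (hε : 0 < ε) (hk : 0 < k) (hh : 0 < h)
    (hCFL : k ≤ h ^ 2 * σ / 6 + 2 / 3 * ε * h)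
    (hρ : IsL2Grid ρ) (hρ' : IsL2Grid ρ') (hg : IsL2VelGrid g) (hg' : IsL2VelGrid g')
    (hτ : VelBound h τ A) (he : Summable fun i => e i ^ 2) (heB : ∑' i, e i ^ 2 * h ≤ B) :
    energy ε h ρ' g' ≤ (1 + k) * (energy ε h ρ g + k * (A / σ)) + k * ((1 + k) * B) := by
  obtain ⟨sR, hR⟩ := energy_step hσ hε hk hh hCFL hρ hg hg' (hτ.isL2VelGrid hh)
    (fun i => by
      obtain ⟨c, hc⟩ := hstep.micro_eq i
      exact velAvg_mul_eq_zero_of_ae_eq_const hc (hstep.avg_zero i))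
    (R := fun i => ρ i - k * velAvg (fun v => v * ((g' i v - g' (i - 1) v) / h))) fun i => rfl
  set R : ℤ → ℝ := fun i => ρ i - k * velAvg (fun v => v * ((g' i v - g' (i - 1) v) / h))
  have h1 : ∑' i, ρ' i ^ 2 ≤ (1 + k) * ∑' i, R i ^ 2 + k * (1 + k) * ∑' i, e i ^ 2 := by
    rw [← tsum_mul_left, ← tsum_mul_left, ← (sR.mul_left _).tsum_add (he.mul_left _)]
    refine Summable.tsum_le_tsum (fun i => ?_) hρ' ((sR.mul_left _).add (he.mul_left _))
    have : ρ' i = R i + k * e i := hstep.macro_eq i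
    rw [this]
    nlinarith [mul_nonneg hk.le (sq_nonneg (R i - e i))]
  have h2 : 0 ≤ ε ^ 2 * ∑' i, velAvg (fun v => g' i v ^ 2) :=
    mul_nonneg (sq_nonneg _) (tsum_nonneg fun _ => velAvg_nonneg fun _ => sq_nonneg _)
  have hA := hτ.tsum_le hh
  unfold energy
  simp only [tsum_mul_right] at hA heB ⊢
  set sρ := ∑' i, ρ i ^ 2
  set sρ' := ∑' i, ρ' i ^ 2
  set sg := ∑' i, velAvg (fun v => g i v ^ 2)
  set sg' := ∑' i, velAvg (fun v => g' i v ^ 2)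
  set sτ := ∑' i, velAvg (fun v => τ i v ^ 2)
  set se := ∑' i, e i ^ 2
  set sR := ∑' i, R i ^ 2
  have h3 : k / σ * (sτ * h) ≤ k * (A / σ) := by
    calc k / σ * (sτ * h) ≤ k / σ * A := by gcongr
      _ = k * (A / σ) := by ring
  calc sρ' * h + ε ^ 2 * (sg' * h) = (sρ' + ε ^ 2 * sg') * h := by ring
    _ ≤ ((1 + k) * (sR + ε ^ 2 * sg') + k * (1 + k) * se) * h := by
        refine mul_le_mul_of_nonneg_right ?_ hh.le
        nlinarith [mul_nonneg hk.le h2]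
    _ ≤ ((1 + k) * (sρ + ε ^ 2 * sg + k / σ * sτ) + k * (1 + k) * se) * h := by gcongr
    _ = (1 + k) * (sρ * h + ε ^ 2 * (sg * h) + k / σ * (sτ * h)) + k * ((1 + k) * (se * h)) := by
        ring
    _ ≤ _ := by gcongr

/-- A discrete Gronwall inequality. -/
theorem discrete_gronwall {E : ℕ → ℝ} {k a b : ℝ} (hk : 0 ≤ k) (ha : 0 ≤ a) (hb : 0 ≤ b)
    (h0 : 0 ≤ E 0) {n : ℕ} (h : ∀ m < n, E (m + 1) ≤ (1 + k) * (E m + k * a) + k * b) :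
    E n ≤ Real.exp (n * k) * (E 0 + n * k * (a + b)) := by
  induction n with
  | zero => simp
  | succ n ih =>
    have h1 := ih fun m hm => h m (hm.trans n.lt_succ_self)
    have h2 := h n n.lt_succ_self
    have h3 : 1 + k ≤ Real.exp k := by linarith [Real.add_one_le_exp k]
    have h4 : (1:ℝ) ≤ Real.exp (n * k) := Real.one_le_exp (by positivity)
    calc E (n + 1) ≤ (1 + k) * (E n + k * a) + k * b := h2
      _ ≤ (1 + k) * (E n + k * (a + b)) := by nlinarith [mul_nonneg hk (mul_nonneg hk hb)]
      _ ≤ (1 + k) * (Real.exp (n * k) * (E 0 + n * k * (a + b))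
            + Real.exp (n * k) * (k * (a + b))) := by
          refine mul_le_mul_of_nonneg_left (add_le_add h1 ?_) (by positivity)
          exact le_mul_of_one_le_left (by positivity) h4
      _ = (1 + k) * (Real.exp (n * k) * (E 0 + (n + 1) * k * (a + b))) := by ring
      _ ≤ Real.exp k * (Real.exp (n * k) * (E 0 + (n + 1) * k * (a + b))) := by gcongr
      _ = Real.exp ((n + 1 : ℕ) * k) * (E 0 + (n + 1 : ℕ) * k * (a + b)) := by
          rw [← mul_assoc, ← Real.exp_add]
          push_cast
          ring_nf

/-! ### Properties of the numerical solution -/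

theorem scatter_halfKernel {E : Type*} [NormedAddCommGroup E] [NormedSpace ℝ E] [CompleteSpace E]
    {φ : ℝ → E} (hφ : Integrable φ velMeasure) (v : ℝ) :
    scatter halfKernel φ v = velAvg φ - φ v := by
  have hi : IntervalIntegrable φ volume (-1) 1 :=
    (intervalIntegrable_iff_integrableOn_Icc_of_le (by norm_num)).2 hφ
  unfold scatter halfKernel velAvg
  rw [intervalIntegral.integral_smul, intervalIntegral.integral_sub hi intervalIntegrable_const,
    smul_sub, intervalIntegral.integral_const, smul_smul]
  norm_num

theorem velAvg_id : velAvg (fun v => v) = 0 := by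
  simp [velAvg, integral_id]

namespace IsScheme

variable {σ ε k h : ℝ} {ρ : ℕ → ℤ → ℝ} {g : ℕ → ℤ → ℝ → ℝ}

/-- The scheme preserves the zero average of `g`. -/
theorem velAvg_eq_zero (hs : IsScheme σ ε k h ρ g) (hk : 0 < k) (h0 : ∀ i, velAvg (g 0 i) = 0)
    (n : ℕ) (i : ℤ) : velAvg (g n i) = 0 := by
  induction n with
  | zero => exact h0 i
  | succ n ih =>
    have int : ∀ n, Integrable (g n i) velMeasure := fun n => (hs.memLp n i).integrable one_le_two
    have a1 := hasVelAvg_of_integrable (int (n + 1))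
    have a0 := hasVelAvg_of_integrable (int n)
    have au := hasVelAvg_of_integrable (integrable_of_memLp_vel (memLp_upwind (hs.memLp n) i))
    have ac : ∀ c : ℝ, HasVelAvg (fun _ => c) c := fun c => ⟨integrable_const c, velAvg_const c⟩
    have av : HasVelAvg (fun v => v) 0 := ⟨integrable_vel_of_continuous continuous_id, velAvg_id⟩
    have L := ((a1.sub a0).const_mul k⁻¹).add
      ((au.sub (ac (velAvg (upwind (g n) i)))).const_mul (1 / (ε * h)))
    have R := (((ac (velAvg (g (n + 1) i))).sub a1).const_mul (σ / ε ^ 2)).sub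
      (av.const_mul (1 / ε ^ 2 * ((ρ n (i + 1) - ρ n i) / h)))
    have e : (fun v => k⁻¹ * (g (n + 1) i v - g n i v)
        + 1 / (ε * h) * (upwind (g n) i v - velAvg (upwind (g n) i))) =ᵐ[velMeasure]
        fun v => σ / ε ^ 2 * (velAvg (g (n + 1) i) - g (n + 1) i v)
          - 1 / ε ^ 2 * ((ρ n (i + 1) - ρ n i) / h) * v := by
      filter_upwards [hs.micro_eq n i] with v hv
      rw [scatter_halfKernel (int (n + 1))] at hv
      rw [← div_eq_inv_mul, hv]
      ring
    have := L.2.symm.trans ((velAvg_congr e).trans R.2)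
    rw [ih] at this
    simp only [sub_self, mul_zero, sub_zero, add_zero] at this
    exact (mul_eq_zero.1 this).resolve_left (inv_ne_zero hk.ne')

/-- The scheme is a perturbed step without residuals. -/
theorem micro_eq_ae (hs : IsScheme σ ε k h ρ g) (hε : 0 < ε) (hk : 0 < k) (hh : 0 < h)
    (h0 : ∀ i, velAvg (g 0 i) = 0) (n : ℕ) (i : ℤ) :
    ∀ᵐ v ∂velMeasure, ε ^ 2 * (g (n + 1) i v - g n i v)
      + k * (ε / h * upwind (g n) i v + σ * g (n + 1) i v + v * ((ρ n (i + 1) - ρ n i) / h))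
      = k * (ε / h * velAvg (upwind (g n) i)) := by
  filter_upwards [hs.micro_eq n i] with v hv
  rw [scatter_halfKernel ((hs.memLp (n + 1) i).integrable one_le_two),
    hs.velAvg_eq_zero hk h0] at hv
  field_simp at hv ⊢
  linarith

theorem isPerturbedStep (hs : IsScheme σ ε k h ρ g) (hε : 0 < ε) (hk : 0 < k) (hh : 0 < h)
    (h0 : ∀ i, velAvg (g 0 i) = 0) (n : ℕ) :
    IsPerturbedStep σ ε k h (ρ n) (ρ (n + 1)) (g n) (g (n + 1)) (fun _ => 0) (fun _ _ => 0) where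
  macro_eq i := by
    have := hs.macro_eq n i
    field_simp at this ⊢
    linarith
  micro_eq i := ⟨_, (hs.micro_eq_ae hε hk hh h0 n i).mono fun v hv => by rw [sub_zero]; exact hv⟩
  avg_zero i := hs.velAvg_eq_zero hk h0 (n + 1) i

end IsScheme

theorem IsL2VelGrid.add {ψ χ : ℤ → ℝ → ℝ} (hψ : IsL2VelGrid ψ) (hχ : IsL2VelGrid χ) :
    IsL2VelGrid fun i v => ψ i v + χ i v :=
  ((hψ.velBound zero_le_one).add zero_le_one (hχ.velBound zero_le_one)).isL2VelGrid one_pos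

theorem IsL2VelGrid.const_mul {ψ : ℤ → ℝ → ℝ} (hψ : IsL2VelGrid ψ) (c : ℝ) :
    IsL2VelGrid fun i v => c * ψ i v :=
  ((hψ.velBound zero_le_one).const_mul zero_le_one c).isL2VelGrid one_pos

theorem IsL2VelGrid.mul_left {ψ : ℤ → ℝ → ℝ} (hψ : IsL2VelGrid ψ) {m : ℝ → ℝ} (hm : Continuous m)
    (hm1 : ∀ v ∈ Icc (-1:ℝ) 1, |m v| ≤ 1) : IsL2VelGrid fun i v => m v * ψ i v :=
  ((hψ.velBound zero_le_one).mul_left zero_le_one hm hm1).isL2VelGrid one_pos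

theorem IsL2VelGrid.congr {ψ χ : ℤ → ℝ → ℝ} (hψ : IsL2VelGrid ψ)
    (h : ∀ i, ψ i =ᵐ[velMeasure] χ i) : IsL2VelGrid χ :=
  ((hψ.velBound zero_le_one).congr h).isL2VelGrid one_pos

theorem IsL2Grid.isL2VelGrid {q : ℤ → ℝ} (hq : IsL2Grid q) : IsL2VelGrid fun i _ => q i :=
  ⟨fun _ => memLp_const _, by simpa only [velAvg_const, IsL2Grid] using hq⟩

theorem velAvg_sq_le {φ : ℝ → ℝ} (hφ : MemLp φ 2 velMeasure) :
    velAvg φ ^ 2 ≤ velAvg fun v => φ v ^ 2 := by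
  have a1 := hasVelAvg_of_integrable (integrable_of_memLp_vel hφ)
  have a2 := hasVelAvg_of_integrable hφ.integrable_sq
  have ac : HasVelAvg (fun _ => velAvg φ ^ 2) (velAvg φ ^ 2) := ⟨integrable_const _, velAvg_const _⟩
  have := ((a1.const_mul (2 * velAvg φ)).sub ac).le a2 fun v _ => by
    nlinarith [sq_nonneg (φ v - velAvg φ)]
  nlinarith

theorem IsL2VelGrid.isL2Grid_velAvg {ψ : ℤ → ℝ → ℝ} (hψ : IsL2VelGrid ψ) :
    IsL2Grid fun i => velAvg (ψ i) :=
  Summable.of_nonneg_of_le (fun _ => sq_nonneg _) (fun i => velAvg_sq_le (hψ.1 i)) hψ.2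

theorem abs_posPart_le {v : ℝ} (hv : v ∈ Icc (-1:ℝ) 1) : |(v + |v|) / 2| ≤ 1 := by
  rcases abs_cases v with ⟨h1, h2⟩ | ⟨h1, h2⟩ <;> rw [h1, abs_le] <;>
    constructor <;> linarith [hv.1, hv.2]

theorem abs_negPart_le {v : ℝ} (hv : v ∈ Icc (-1:ℝ) 1) : |(v - |v|) / 2| ≤ 1 := by
  rcases abs_cases v with ⟨h1, h2⟩ | ⟨h1, h2⟩ <;> rw [h1, abs_le] <;>
    constructor <;> linarith [hv.1, hv.2]

theorem IsL2VelGrid.upwind {g : ℤ → ℝ → ℝ} (hg : IsL2VelGrid g) : IsL2VelGrid (upwind g) :=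
  ((hg.sub (hg.shift (-1))).mul_left (m := fun v => (v + |v|) / 2) (by fun_prop)
    fun _ => abs_posPart_le).add
    (((hg.shift 1).sub hg).mul_left (m := fun v => (v - |v|) / 2) (by fun_prop)
      fun _ => abs_negPart_le)

/-- The numerical solution stays square-summable: the collision term, although implicit, is
diagonal on functions of zero average. -/
theorem IsScheme.isL2 {σ ε k h : ℝ} {ρ : ℕ → ℤ → ℝ} {g : ℕ → ℤ → ℝ → ℝ}
    (hs : IsScheme σ ε k h ρ g) (hσ : 0 < σ) (hε : 0 < ε) (hk : 0 < k) (hh : 0 < h)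
    (h0 : ∀ i, velAvg (g 0 i) = 0) (hρ0 : IsL2Grid (ρ 0)) (hg0 : IsL2VelGrid (g 0)) (n : ℕ) :
    IsL2Grid (ρ n) ∧ IsL2VelGrid (g n) := by
  induction n with
  | zero => exact ⟨hρ0, hg0⟩
  | succ n ih =>
    obtain ⟨hρ, hg⟩ := ih
    have hq : IsL2Grid fun i => (ρ n (i + 1) - ρ n i) := summable_sq_sub (summable_shift hρ 1) hρ
    have hd : 0 < ε ^ 2 + k * σ := by positivity
    have hg' : IsL2VelGrid (g (n + 1)) := by
      have := (((hg.const_mul (ε ^ 2)).add ((hg.upwind.isL2Grid_velAvg.isL2VelGrid.sub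
        hg.upwind).const_mul (k * (ε / h)))).sub
        ((hq.isL2VelGrid.mul_left (m := fun v => v) continuous_id
          fun v hv => abs_le.2 hv).const_mul (k / h))).const_mul (ε ^ 2 + k * σ)⁻¹
      refine this.congr fun i => ?_
      filter_upwards [hs.micro_eq_ae hε hk hh h0 n i] with v hv
      rw [inv_mul_eq_iff_eq_mul₀ hd.ne']
      linear_combination -hv
    refine ⟨?_, hg'⟩
    have ha : IsL2Grid fun i => velAvg (fun v => v * g (n + 1) i v) := summable_velAvg_mul_sq hg'
    have := summable_sq_sub hρ (summable_sq_const_mul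
      (summable_sq_sub ha (summable_shift ha (-1))) (k / h))
    refine this.congr fun i => ?_
    have e := (hs.isPerturbedStep hε hk hh h0 n).macro_eq i
    rw [velAvg_mul_diff hg'.1] at e
    rw [e]
    simp only [← sub_eq_add_neg]
    ring

/-! ### Taylor expansion in time -/

namespace IsCmBounded

variable {X : Type*} [NormedAddCommGroup X] [NormedSpace ℝ X] {T M : ℝ} {u : ℝ → X}

theorem norm_le {m : ℕ} (hu : IsCmBounded m T M u) {t : ℝ} (ht : t ∈ Icc 0 T) : ‖u t‖ ≤ M := by
  simpa using hu.2 0 (Nat.zero_le m) t ht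

theorem hasDerivWithinAt (hu : IsCmBounded 2 T M u) {t : ℝ} (ht : t ∈ Icc 0 T) :
    HasDerivWithinAt u (derivWithin u (Icc 0 T) t) (Icc 0 T) t :=
  ((hu.1.differentiableOn (by norm_num)) t ht).hasDerivWithinAt

theorem norm_sub_le (hu : IsCmBounded 2 T M u) {a b : ℝ} (ha : a ∈ Icc 0 T) (hb : b ∈ Icc 0 T) :
    ‖u b - u a‖ ≤ M * |b - a| :=
  Convex.norm_image_sub_le_of_norm_hasDerivWithin_le (fun _ ht => hu.hasDerivWithinAt ht)
    (fun t ht => by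
      have := hu.2 1 (by norm_num) t ht
      rwa [iteratedDerivWithin_one] at this) (convex_Icc 0 T) ha hb

theorem norm_derivWithin_sub_le (hT : 0 < T) (hu : IsCmBounded 2 T M u) {a b : ℝ}
    (ha : a ∈ Icc 0 T) (hb : b ∈ Icc 0 T) :
    ‖derivWithin u (Icc 0 T) b - derivWithin u (Icc 0 T) a‖ ≤ M * |b - a| := by
  have hd : ContDiffOn ℝ 1 (derivWithin u (Icc 0 T)) (Icc 0 T) :=
    hu.1.derivWithin (uniqueDiffOn_Icc hT) (by norm_num)
  refine Convex.norm_image_sub_le_of_norm_derivWithin_le (s := Icc 0 T)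
    (hd.differentiableOn (by norm_num)) (fun t ht => ?_) (convex_Icc 0 T) ha hb
  have := hu.2 2 le_rfl t ht
  rw [iteratedDerivWithin_succ] at this
  refine le_trans (le_of_eq ?_) this
  congr 1
  refine derivWithin_congr (fun s hs => ?_) ?_ <;> rw [iteratedDerivWithin_one]

/-- Difference quotients in time are consistent of order one, at both endpoints. -/
theorem norm_diffQuot_sub_le (hT : 0 < T) (hu : IsCmBounded 2 T M u) {a c k : ℝ} (hk : 0 < k)
    (ha : a ∈ Icc 0 T) (hb : a + k ∈ Icc 0 T) (hc : c ∈ Icc a (a + k)) :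
    ‖k⁻¹ • (u (a + k) - u a) - derivWithin u (Icc 0 T) c‖ ≤ M * k := by
  have hsub : Icc a (a + k) ⊆ Icc 0 T := Icc_subset_Icc ha.1 hb.2
  have hM : 0 ≤ M := (norm_nonneg _).trans (hu.norm_le ha)
  have := Convex.norm_image_sub_le_of_norm_hasDerivWithin_le (s := Icc a (a + k))
    (f := fun s => u s - s • derivWithin u (Icc 0 T) c)
    (f' := fun s => derivWithin u (Icc 0 T) s - (1:ℝ) • derivWithin u (Icc 0 T) c) (C := M * k)
    (fun s hs => (((hu.hasDerivWithinAt (hsub hs)).mono hsub)).sub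
      ((hasDerivWithinAt_id s _).smul_const _))
    (fun s hs => by
      rw [one_smul]
      refine (hu.norm_derivWithin_sub_le hT (hsub hc) (hsub hs)).trans ?_
      gcongr
      rw [abs_le]
      constructor <;> linarith [hs.1, hs.2, hc.1, hc.2])
    (convex_Icc _ _) (x := a) (y := a + k) ⟨le_rfl, by linarith⟩ ⟨by linarith, le_rfl⟩
  rw [add_sub_cancel_left, Real.norm_eq_abs, abs_of_pos hk] at this
  have e : k⁻¹ • (u (a + k) - u a) - derivWithin u (Icc 0 T) c
      = k⁻¹ • (u (a + k) - (a + k) • derivWithin u (Icc 0 T) c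
        - (u a - a • derivWithin u (Icc 0 T) c)) := by
    have : derivWithin u (Icc 0 T) c = k⁻¹ • (k • derivWithin u (Icc 0 T) c) := by
      rw [smul_smul, inv_mul_cancel₀ hk.ne', one_smul]
    rw [add_smul]
    nth_rw 1 [this]
    rw [← smul_sub]
    congr 1
    abel
  rw [e, norm_smul, norm_inv, Real.norm_eq_abs, abs_of_pos hk, inv_mul_le_iff₀ hk]
  linarith

end IsCmBounded

/-! ### The equations at a point -/

namespace Sobolev

/-- The `j`-th derivative as a bounded operator into `L²(ℝ)`. -/
noncomputable def dxL {k : ℕ} (j : Fin (k + 1)) : Sobolev k →L[ℝ] L2R :=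
  (PiLp.proj 2 (fun _ : Fin (k + 1) => L2R) j).comp (sobolev k).subtypeL

theorem evalL_eq_of_dxL_eq {u w : Sobolev 1} (h : dxL 0 u = dxL 0 w) (x : ℝ) :
    evalL x u = evalL x w :=
  congrFun (val_congr h) x

end Sobolev

open Sobolev

theorem memLp_clm {X Y : Type*} [NormedAddCommGroup X] [NormedSpace ℝ X] [NormedAddCommGroup Y]
    [NormedSpace ℝ Y] (L : X →L[ℝ] Y) (φ : Lp X 2 velMeasure) :
    MemLp (fun v => L (φ v)) 2 velMeasure := L.comp_memLp' (Lp.memLp φ)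

/-- The velocity average of `v φ(v)`, tested with a functional. -/
theorem clm_velAvg_smul {X Y : Type*} [NormedAddCommGroup X] [NormedSpace ℝ X] [CompleteSpace X]
    [NormedAddCommGroup Y] [NormedSpace ℝ Y] [CompleteSpace Y] (L : X →L[ℝ] Y)
    (φ : Lp X 2 velMeasure) :
    L (velAvg fun v => v • φ v) = velAvg fun v => v • L (φ v) := by
  have := velAvg_clm L (integrable_of_memLp_vel (memLp_vel_smul continuous_id (Lp.memLp φ)))
  simp only [id, map_smul] at this
  exact this.symm

theorem norm_velAvg_smul_le {X : Type*} [NormedAddCommGroup X] [InnerProductSpace ℝ X]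
    (φ : Lp X 2 velMeasure) : ‖velAvg fun v => v • φ v‖ ^ 2 ≤ ‖φ‖ ^ 2 := by
  have hn : MemLp (fun v => ‖φ v‖) 2 velMeasure := (Lp.memLp φ).norm
  have h1 : ‖velAvg fun v => v • φ v‖ ≤ velAvg fun v => ‖φ v‖ := by
    rw [velAvg_eq, velAvg_eq, norm_smul, Real.norm_of_nonneg (by norm_num), smul_eq_mul]
    gcongr
    refine (norm_integral_le_integral_norm _).trans ?_
    refine integral_mono_ae (integrable_of_memLp_vel (memLp_vel_smul continuous_id
      (Lp.memLp φ)) |>.norm) (integrable_of_memLp_vel hn) ?_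
    filter_upwards [ae_velMeasure_mem] with v hv
    rw [norm_smul]
    exact mul_le_of_le_one_left (norm_nonneg _) (abs_le.2 hv)
  calc ‖velAvg fun v => v • φ v‖ ^ 2 ≤ (velAvg fun v => ‖φ v‖) ^ 2 := by gcongr
    _ ≤ velAvg fun v => ‖φ v‖ ^ 2 := velAvg_sq_le hn
    _ = 1 / 2 * ‖φ‖ ^ 2 := by rw [velAvg_eq, norm_sq_eq_integral_vel, smul_eq_mul]
    _ ≤ ‖φ‖ ^ 2 := by nlinarith [sq_nonneg ‖φ‖]

theorem coeFn_inclVel (φ : VelSobolev 3) : ∀ᵐ v ∂velMeasure, inclVel φ v = inclH (φ v) :=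
  ContinuousLinearMap.coeFn_compLpL inclH φ

namespace IsSolution

variable {σ ε T : ℝ} {ρ : ℝ → Sobolev 3} {g : ℝ → VelSobolev 3}

theorem velAvg_val_eq_zero (hs : IsSolution σ ε T ρ g) {t : ℝ} (ht : t ∈ Icc 0 T) (x : ℝ) :
    velAvg (fun v => (g t v).val x) = 0 := by
  have := velAvg_clm ((evalL x).comp inclH) (integrable_of_memLp_vel (Lp.memLp (g t)))
  rw [hs.avg_zero t ht, map_zero] at this
  exact this

theorem macro_eq_val (hs : IsSolution σ ε T ρ g) {t : ℝ} (ht : t ∈ Icc 0 T) (x : ℝ) :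
    evalL x (derivWithin (fun s => inclH (ρ s)) (Icc 0 T) t)
      = -(derivH 1 (velAvg fun v => v • g t v)).val x := by
  have h := hs.macro_eq t ht
  have h1 : dxL 0 (derivWithin (fun s => inclH (ρ s)) (Icc 0 T) t)
      = dxL 0 (-derivH 1 (velAvg fun v => v • g t v)) := by
    rw [map_neg]
    exact eq_neg_of_add_eq_zero_left h
  rw [evalL_eq_of_dxL_eq h1 x, map_neg, evalL_apply]

theorem micro_eq_val (hs : IsSolution σ ε T ρ g) (hε : 0 < ε) {t : ℝ} (ht : t ∈ Icc 0 T) :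
    ∀ᵐ v ∂velMeasure, ∀ x,
      ε ^ 2 * evalL x (derivWithin (fun s => inclVel (g s)) (Icc 0 T) t v)
        + ε * (v * (derivH 1 (g t v)).val x) + σ * (g t v).val x + v * (derivH 1 (ρ t)).val x
      = ε * velAvg fun w => w * (derivH 1 (g t w)).val x := by
  filter_upwards [hs.micro_eq t ht] with v hv x
  rw [scatter_halfKernel (integrable_of_memLp_vel (Lp.memLp (g t))), hs.avg_zero t ht,
    zero_sub] at hv
  have e1 : (velAvg fun w => w • dx 1 (g t w)) = dxL 0 (derivH 1 (velAvg fun w => w • g t w)) := by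
    have := clm_velAvg_smul ((dxL 0).comp (derivH 1)) (g t)
    exact this.symm
  have e2 : (velAvg fun w => w * (derivH 1 (g t w)).val x)
      = evalL x (derivH 1 (velAvg fun w => w • g t w)) := by
    have := clm_velAvg_smul ((evalL x).comp (derivH 1)) (g t)
    exact this.symm
  rw [e1] at hv
  set p := derivWithin (fun s => inclVel (g s)) (Icc 0 T) t v
  set q := derivH 1 (velAvg fun w => w • g t w)
  have h1 : dxL 0 (p + (1 / ε) • (v • derivH 1 (g t v) - q))
      = dxL 0 ((σ / ε ^ 2) • (-inclH (g t v)) - (1 / ε ^ 2) • v • derivH 1 (ρ t)) := by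
    simp only [map_add, map_sub, map_smul, map_neg]
    have e3 : dx 0 (-g t v) = -dxL 0 (inclH (g t v)) := rfl
    rw [e3] at hv
    exact hv
  have h2 := evalL_eq_of_dxL_eq h1 x
  simp only [map_add, map_sub, map_smul, map_neg, smul_eq_mul] at h2
  rw [e2]
  simp only [evalL_apply, val_inclH] at h2 ⊢
  field_simp at h2
  linarith

end IsSolution

/-! ### Consistency of the scheme -/

/-- The grid norm of grid-bounded functionals applied to one function. -/
theorem IsGridBounded.summable {X : Type*} [NormedAddCommGroup X] [NormedSpace ℝ X] {h C : ℝ}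
    {ℓ : ℤ → X →L[ℝ] ℝ} (hh : 0 < h) (hℓ : IsGridBounded h C ℓ) (u : X) :
    Summable fun i => ℓ i u ^ 2 := by
  have : Summable fun i => ℓ i u ^ 2 * h :=
    summable_of_sum_le (fun i => mul_nonneg (sq_nonneg _) hh.le) (hℓ u)
  exact (summable_mul_right_iff hh.ne').1 this

theorem IsGridBounded.tsum_le {X : Type*} [NormedAddCommGroup X] [NormedSpace ℝ X] {h C : ℝ}
    {ℓ : ℤ → X →L[ℝ] ℝ} (hh : 0 < h) (hℓ : IsGridBounded h C ℓ) (u : X) :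
    ∑' i, ℓ i u ^ 2 * h ≤ C * ‖u‖ ^ 2 :=
  ((hℓ.summable hh u).mul_right h).tsum_le_of_sum_le (hℓ u)

/-- Functions that do not depend on `v`. -/
theorem IsGridBounded.velBound_const {X : Type*} [NormedAddCommGroup X] [NormedSpace ℝ X] {h C : ℝ}
    {ℓ : ℤ → X →L[ℝ] ℝ} (hℓ : IsGridBounded h C ℓ) (u : X) :
    VelBound h (fun i _ => ℓ i u) (C * ‖u‖ ^ 2) :=
  ⟨fun _ => memLp_const _, fun F => by simpa only [velAvg_const] using hℓ u F⟩

theorem tsum_sq_add_mul_le {h A B : ℝ} (hh : 0 ≤ h) {x y : ℤ → ℝ} (hx : Summable fun i => x i ^ 2)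
    (hy : Summable fun i => y i ^ 2) (hA : ∑' i, x i ^ 2 * h ≤ A) (hB : ∑' i, y i ^ 2 * h ≤ B) :
    ∑' i, (x i + y i) ^ 2 * h ≤ 2 * A + 2 * B := by
  have := ((summable_sq_add hx hy).mul_right h).tsum_le_tsum (fun i => by
    show (x i + y i) ^ 2 * h ≤ 2 * (x i ^ 2 * h) + 2 * (y i ^ 2 * h)
    nlinarith [mul_nonneg (sq_nonneg (x i - y i)) hh])
    (((hx.mul_right h).mul_left 2).add ((hy.mul_right h).mul_left 2))
  rw [((hx.mul_right h).mul_left 2).tsum_add ((hy.mul_right h).mul_left 2), tsum_mul_left,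
    tsum_mul_left] at this
  linarith

section exact

variable {σ ε T M k h : ℝ} {ρ : ℝ → Sobolev 3} {g : ℝ → VelSobolev 3}

theorem sq_norm_le {X : Type*} [NormedAddCommGroup X] {u : X} {K : ℝ} (h : ‖u‖ ≤ K) :
    ‖u‖ ^ 2 ≤ K ^ 2 := pow_le_pow_left₀ (norm_nonneg u) h 2

/-- The consistency error of the macro equation, which is centred at the time `t + k`. -/
theorem exists_macro_residual (hT : 0 < T) (hreg : IsRegular T M ρ g) (hs : IsSolution σ ε T ρ g)
    (hk : 0 < k) (hh : 0 < h) {t : ℝ} (ht : t ∈ Icc 0 T) (ht' : t + k ∈ Icc 0 T) :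
    ∃ e : ℤ → ℝ, (Summable fun i => e i ^ 2) ∧
      ∑' i, e i ^ 2 * h ≤ 2 * (2 * (1 + h ^ 2) * (M * k) ^ 2) + 2 * (h ^ 4 * M ^ 2) ∧
      ∀ i : ℤ, (ρ (t + k)).val (i * h) = (ρ t).val (i * h)
        - k * velAvg (fun v => v * (((g (t + k) v).val ((i + 1 / 2) * h)
          - (g (t + k) v).val (((i - 1 : ℤ) + 1 / 2) * h)) / h)) + k * e i := by
  set w : Sobolev 1 := k⁻¹ • (inclH (ρ (t + k)) - inclH (ρ t))
    - derivWithin (fun s => inclH (ρ s)) (Icc 0 T) (t + k) with hw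
  set W : Sobolev 3 := velAvg fun v => v • g (t + k) v with hW
  have hw1 : ‖w‖ ≤ M * k := hreg.rho_C2_H1.norm_diffQuot_sub_le hT hk ht ht'
    ⟨by linarith, le_rfl⟩
  have hW1 : ‖W‖ ^ 2 ≤ M ^ 2 := (norm_velAvg_smul_le _).trans
    (sq_norm_le (hreg.g_C0_H3.norm_le ht'))
  have b1 := isGridBounded_evalL hh 0
  have b2 := isGridBounded_diffDefect_half hh (-(h / 2))
  refine ⟨fun i => evalL (0 + i * h) w + diffDefect h (1 / 2) (-(h / 2) + i * h) W,
    summable_sq_add (b1.summable hh w) (b2.summable hh W),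
    tsum_sq_add_mul_le hh.le (b1.summable hh w) (b2.summable hh W)
      ((b1.tsum_le hh w).trans ?_) ((b2.tsum_le hh W).trans ?_), fun i => ?_⟩
  · have := sq_norm_le hw1
    gcongr
  · gcongr
  · have hval : ∀ y, W.val y = velAvg fun v => v * (g (t + k) v).val y := fun y =>
      clm_velAvg_smul ((evalL y).comp inclH) (g (t + k))
    have int : ∀ y, HasVelAvg (fun v => v * (g (t + k) v).val y) (W.val y) := fun y =>
      ⟨integrable_of_memLp_vel (memLp_vel_mul continuous_id
        (memLp_clm ((evalL y).comp inclH) (g (t + k)))), (hval y).symm⟩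
    have e1 : velAvg (fun v => v * (((g (t + k) v).val ((i + 1 / 2) * h)
          - (g (t + k) v).val (((i - 1 : ℤ) + 1 / 2) * h)) / h))
        = h⁻¹ * (W.val ((i + 1 / 2) * h) - W.val (((i - 1 : ℤ) + 1 / 2) * h)) := by
      rw [← (((int ((i + 1 / 2) * h)).sub (int (((i - 1 : ℤ) + 1 / 2) * h))).const_mul h⁻¹).2]
      congr 1
      funext v
      rw [div_eq_inv_mul]
      ring
    have e2 : evalL (0 + i * h) w = k⁻¹ * ((ρ (t + k)).val (i * h) - (ρ t).val (i * h))
        + (derivH 1 W).val (i * h) := by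
      rw [hw, map_sub, zero_add, hs.macro_eq_val ht', map_smul, map_sub]
      simp only [evalL_apply, val_inclH, smul_eq_mul, sub_neg_eq_add]
      rfl
    rw [e1]
    beta_reduce
    rw [e2, diffDefect_apply]
    have p1 : -(h / 2) + i * h + h = (i + 1 / 2) * h := by ring
    have p2 : -(h / 2) + i * h = ((i - 1 : ℤ) + 1 / 2) * h := by push_cast; ring
    have p3 : -(h / 2) + i * h + 1 / 2 * h = i * h := by ring
    rw [p1, p3, p2]
    field_simp
    ring

/-- The residual of the micro equation for a function `φ` of `x` and `v` and a function `r` of `x`: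
`w` is the error of the difference quotient of `φ` in time, `z` the increment of `φ` in time. -/
noncomputable def microResidual (σ ε h : ℝ) (w z : VelSobolev 1) (r : Sobolev 3) (φ : VelSobolev 3)
    (i : ℤ) (v : ℝ) : ℝ :=
  (ε ^ 2 * evalL (h / 2 + i * h) (w v) + σ * evalL (h / 2 + i * h) (z v))
    + (v * diffDefect h (1 / 2) (0 + i * h) r
      + ε * ((v + |v|) / 2 * diffDefect h 1 (-(h / 2) + i * h) (φ v)
        + (v - |v|) / 2 * diffDefect h 0 (h / 2 + i * h) (φ v)))

theorem velBound_microResidual (σ ε : ℝ) {K : ℝ} (hh : 0 < h) {w z : VelSobolev 1} {r : Sobolev 3}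
    {φ : VelSobolev 3} (hw : ‖w‖ ≤ K) (hz : ‖z‖ ≤ K) (hr : ‖r‖ ≤ M)
    (hφ : ‖φ‖ ≤ M) :
    VelBound h (microResidual σ ε h w z r φ)
      (2 * (2 * ((ε ^ 2) ^ 2 * (2 * (1 + h ^ 2) * K ^ 2)) + 2 * (σ ^ 2 * (2 * (1 + h ^ 2) * K ^ 2)))
        + 2 * (2 * (h ^ 4 * M ^ 2)
          + 2 * (ε ^ 2 * (2 * (h ^ 2 * M ^ 2) + 2 * (h ^ 2 * M ^ 2))))) := by
  have b1 := isGridBounded_evalL hh (h / 2)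
  have v1 := (b1.velBound w).mono
    (mul_le_mul_of_nonneg_left (sq_norm_le (u := w) hw) (by positivity))
  have v2 := (b1.velBound z).mono
    (mul_le_mul_of_nonneg_left (sq_norm_le (u := z) hz) (by positivity))
  have v3 := (((isGridBounded_diffDefect_half hh 0).velBound_const r).mono
    (mul_le_mul_of_nonneg_left (sq_norm_le (u := r) hr) (by positivity))).mul_left hh.le
      (m := fun v => v) continuous_id fun v hv => abs_le.2 hv
  have v4 := (((isGridBounded_diffDefect hh (θ := 1) ⟨zero_le_one, le_rfl⟩ (-(h / 2))).velBound
    φ).mono (mul_le_mul_of_nonneg_left (sq_norm_le (u := φ) hφ) (by positivity))).mul_left hh.le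
      (m := fun v => (v + |v|) / 2) (by fun_prop) fun _ => abs_posPart_le
  have v5 := (((isGridBounded_diffDefect hh (θ := 0) ⟨le_rfl, zero_le_one⟩ (h / 2)).velBound
    φ).mono (mul_le_mul_of_nonneg_left (sq_norm_le (u := φ) hφ) (by positivity))).mul_left hh.le
      (m := fun v => (v - |v|) / 2) (by fun_prop) fun _ => abs_negPart_le
  exact ((v1.const_mul hh.le (ε ^ 2)).add hh.le (v2.const_mul hh.le σ)).add hh.le
    (v3.add hh.le ((v4.add hh.le v5).const_mul hh.le ε))

/-- The consistency error of the micro equation, which is centred at the time `t`. The average in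
the transport term of the equation does not depend on `v`, and only contributes to the constant. -/
theorem micro_eq_exact (hs : IsSolution σ ε T ρ g) (hε : 0 < ε) (hk : 0 < k) (hh : 0 < h) {t : ℝ}
    (ht : t ∈ Icc 0 T) (i : ℤ) :
    ∃ c : ℝ, ∀ᵐ v ∂velMeasure,
        ε ^ 2 * ((g (t + k) v).val ((i + 1 / 2) * h) - (g t v).val ((i + 1 / 2) * h))
        + k * (ε / h * upwind (fun i v => (g t v).val ((i + 1 / 2) * h)) i v
          + σ * (g (t + k) v).val ((i + 1 / 2) * h)
          + v * (((ρ t).val ((i + 1 : ℤ) * h) - (ρ t).val (i * h)) / h)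
          - microResidual σ ε h (k⁻¹ • (inclVel (g (t + k)) - inclVel (g t))
            - derivWithin (fun s => inclVel (g s)) (Icc 0 T) t)
            (inclVel (g (t + k)) - inclVel (g t)) (ρ t) (g t) i v) = c := by
  set dg : VelSobolev 1 := derivWithin (fun s => inclVel (g s)) (Icc 0 T) t with hdg
  refine ⟨k * (ε * velAvg fun w => w * (derivH 1 (g t w)).val ((i + 1 / 2) * h)), ?_⟩
  filter_upwards [hs.micro_eq_val hε ht, coeFn_inclVel (g t), coeFn_inclVel (g (t + k)),
    Lp.coeFn_sub (k⁻¹ • (inclVel (g (t + k)) - inclVel (g t))) dg,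
    Lp.coeFn_smul k⁻¹ (inclVel (g (t + k)) - inclVel (g t)),
    Lp.coeFn_sub (inclVel (g (t + k))) (inclVel (g t))] with v hv h1 h2 h3 h4 h5
  have hx := hv ((i + 1 / 2) * h)
  rw [← hx, microResidual, h3, Pi.sub_apply, h4, Pi.smul_apply, h5, Pi.sub_apply, h1, h2,
    diffDefect_apply, diffDefect_apply, diffDefect_apply]
  have p1 : h / 2 + i * h = (i + 1 / 2) * h := by ring
  have p2 : (0:ℝ) + i * h = i * h := zero_add _
  have p3 : i * h + h = ((i + 1 : ℤ) : ℝ) * h := by push_cast; ring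
  have p4 : (i:ℝ) * h + 1 / 2 * h = (i + 1 / 2) * h := by ring
  have p5 : -(h / 2) + i * h + h = (i + 1 / 2) * h := by ring
  have p6 : -(h / 2) + i * h + 1 * h = (i + 1 / 2) * h := by ring
  have p7 : -(h / 2) + i * h = ((i - 1 : ℤ) + 1 / 2) * h := by push_cast; ring
  have p8 : (i + 1 / 2) * h + h = ((i + 1 : ℤ) + 1 / 2) * h := by push_cast; ring
  have p9 : ((i:ℝ) + 1 / 2) * h + 0 * h = (i + 1 / 2) * h := by ring
  rw [p1, p2, p3, p4, p5, p6, p7, p8, p9]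
  simp only [map_sub, map_smul, smul_eq_mul, evalL_apply, val_inclH, upwind]
  generalize (dg v).val ((i + 1 / 2) * h) = y₁
  generalize (g (t + k) v).val ((i + 1 / 2) * h) = y₂
  generalize (g t v).val ((i + 1 / 2) * h) = y₃
  generalize (g t v).val (((i + 1 : ℤ) + 1 / 2) * h) = y₄
  generalize (g t v).val (((i - 1 : ℤ) + 1 / 2) * h) = y₅
  generalize (derivH 1 (g t v)).val ((i + 1 / 2) * h) = y₆
  generalize (derivH 1 (ρ t)).val ((i + 1 / 2) * h) = y₇
  generalize (ρ t).val ((i + 1 : ℤ) * h) = y₈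
  generalize (ρ t).val (i * h) = y₉
  generalize |v| = a
  field_simp
  ring

theorem velBound_exact (hreg : IsRegular T M ρ g) (hh : 0 < h) {t : ℝ} (ht : t ∈ Icc 0 T) :
    VelBound h (fun i v => (g t v).val ((i + 1 / 2) * h)) (2 * (1 + h ^ 2) * M ^ 2) := by
  have := ((isGridBounded_evalL hh (h / 2)).velBound (inclVel (g t))).mono
    (mul_le_mul_of_nonneg_left (sq_norm_le (hreg.g_C2_H1.norm_le ht)) (by positivity))
  refine this.congr fun i => ?_
  filter_upwards [coeFn_inclVel (g t)] with v hv
  rw [hv]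
  have p1 : h / 2 + i * h = (i + 1 / 2) * h := by ring
  simp only [evalL_apply, val_inclH, p1]

theorem isL2Grid_exact (hh : 0 < h) (t : ℝ) : IsL2Grid fun i => (ρ t).val (i * h) := by
  have := (isGridBounded_evalL hh 0).summable hh (inclH (ρ t))
  simpa only [evalL_apply, val_inclH, zero_add, IsL2Grid] using this

theorem tsum_exact_le (hreg : IsRegular T M ρ g) (hh : 0 < h) {t : ℝ} (ht : t ∈ Icc 0 T) :
    ∑' i : ℤ, (ρ t).val (i * h) ^ 2 * h ≤ 2 * (1 + h ^ 2) * M ^ 2 := by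
  have := (isGridBounded_evalL hh 0).tsum_le hh (inclH (ρ t))
  simp only [evalL_apply, val_inclH, zero_add] at this
  exact this.trans (mul_le_mul_of_nonneg_left (sq_norm_le (hreg.rho_C2_H1.norm_le ht))
    (by positivity))

theorem energy_exact_le (hreg : IsRegular T M ρ g) (hh : 0 < h) {t : ℝ} (ht : t ∈ Icc 0 T) :
    energy ε h (fun i => (ρ t).val (i * h)) (fun i v => (g t v).val ((i + 1 / 2) * h))
      ≤ (1 + ε ^ 2) * (2 * (1 + h ^ 2) * M ^ 2) := by
  have h1 := tsum_exact_le hreg hh ht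
  have h2 := mul_le_mul_of_nonneg_left ((velBound_exact hreg hh ht).tsum_le hh) (sq_nonneg ε)
  unfold energy
  linarith

end exact

/-! ### Convergence -/

theorem energy_le_of_isPerturbedStep {σ ε k h T A B : ℝ} {ρ : ℕ → ℤ → ℝ} {g : ℕ → ℤ → ℝ → ℝ}
    (hσ : 0 < σ) (hε : 0 < ε) (hk : 0 < k) (hh : 0 < h) (hT : 0 ≤ T)
    (hCFL : k ≤ h ^ 2 * σ / 6 + 2 / 3 * ε * h) (hA : 0 ≤ A) (hB : 0 ≤ B) {n : ℕ}
    (hL2 : ∀ m ≤ n, IsL2Grid (ρ m) ∧ IsL2VelGrid (g m))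
    (hstep : ∀ m < n, ∃ e τ, IsPerturbedStep σ ε k h (ρ m) (ρ (m + 1)) (g m) (g (m + 1)) e τ ∧
      VelBound h τ A ∧ (Summable fun i => e i ^ 2) ∧ ∑' i, e i ^ 2 * h ≤ B)
    (hn : n * k ≤ T) :
    energy ε h (ρ n) (g n)
      ≤ Real.exp T * (energy ε h (ρ 0) (g 0) + T * (A / σ + (1 + T) * B)) := by
  have h0 := energy_nonneg (ε := ε) hh.le (ρ 0) (g 0)
  have hgr := discrete_gronwall (E := fun m => energy ε h (ρ m) (g m)) (a := A / σ)
    (b := (1 + k) * B) hk.le (by positivity) (by positivity) h0 (n := n) fun m hm => by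
      obtain ⟨e, τ, h1, h2, h3, h4⟩ := hstep m hm
      exact h1.energy_le hσ hε hk hh hCFL (hL2 m hm.le).1 (hL2 (m + 1) hm).1 (hL2 m hm.le).2
        (hL2 (m + 1) hm).2 h2 h3 h4
  refine hgr.trans ?_
  have h1 : n * k * (A / σ + (1 + k) * B) ≤ T * (A / σ + (1 + T) * B) := by
    rcases n.eq_zero_or_pos with rfl | hpos
    · simp only [Nat.cast_zero, zero_mul]
      positivity
    · have : (1:ℝ) ≤ n := by exact_mod_cast hpos
      have : k ≤ T := by nlinarith
      gcongr
  exact mul_le_mul (Real.exp_le_exp.2 hn) (by linarith) (by positivity) (Real.exp_pos _).le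

/-- The difference of a perturbed and of an unperturbed step. -/
theorem IsPerturbedStep.sub {σ ε k h : ℝ} {ρ₁ ρ₁' ρ₂ ρ₂' e : ℤ → ℝ} {g₁ g₁' g₂ g₂' τ : ℤ → ℝ → ℝ}
    (h₁ : IsPerturbedStep σ ε k h ρ₁ ρ₁' g₁ g₁' e τ)
    (h₂ : IsPerturbedStep σ ε k h ρ₂ ρ₂' g₂ g₂' (fun _ => 0) fun _ _ => 0)
    (m₁ : ∀ i, MemLp (g₁' i) 2 velMeasure) (m₂ : ∀ i, MemLp (g₂' i) 2 velMeasure) :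
    IsPerturbedStep σ ε k h (fun i => ρ₁ i - ρ₂ i) (fun i => ρ₁' i - ρ₂' i)
      (fun i v => g₁ i v - g₂ i v) (fun i v => g₁' i v - g₂' i v) e τ where
  macro_eq i := by
    have a : ∀ {G : ℤ → ℝ → ℝ}, (∀ i, MemLp (G i) 2 velMeasure) → ∀ i,
        HasVelAvg (fun v => v * G i v) (velAvg fun v => v * G i v) := fun hG i =>
      hasVelAvg_of_integrable (integrable_of_memLp_vel (memLp_vel_mul continuous_id (hG i)))
    have key : ∀ i, velAvg (fun v => v * (g₁' i v - g₂' i v))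
        = velAvg (fun v => v * g₁' i v) - velAvg fun v => v * g₂' i v := fun i => by
      rw [← ((a m₁ i).sub (a m₂ i)).2]
      simp only [mul_sub]
    rw [velAvg_mul_diff (G := fun i v => g₁' i v - g₂' i v) (fun i => (m₁ i).sub (m₂ i)), key, key,
      h₁.macro_eq, h₂.macro_eq, velAvg_mul_diff m₁, velAvg_mul_diff m₂]
    ring
  micro_eq i := by
    obtain ⟨c₁, hc₁⟩ := h₁.micro_eq i
    obtain ⟨c₂, hc₂⟩ := h₂.micro_eq i
    refine ⟨c₁ - c₂, ?_⟩
    filter_upwards [hc₁, hc₂] with v h1 h2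
    rw [← h1, ← h2]
    unfold upwind
    ring
  avg_zero i := by
    rw [velAvg_sub (integrable_of_memLp_vel (m₁ i)) (integrable_of_memLp_vel (m₂ i)), h₁.avg_zero,
      h₂.avg_zero, sub_zero]

theorem energy_congr {ε h : ℝ} {ρ ρ' : ℤ → ℝ} {g g' : ℤ → ℝ → ℝ} (hρ : ∀ i, ρ i = ρ' i)
    (hg : ∀ i, g i =ᵐ[velMeasure] g' i) : energy ε h ρ g = energy ε h ρ' g' := by
  have : ∀ i, velAvg (fun v => g i v ^ 2) = velAvg fun v => g' i v ^ 2 := fun i =>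
    velAvg_congr ((hg i).mono fun v hv => by simp only [hv])
  simp only [energy, hρ, this]

theorem energy_sub_le {ε h : ℝ} (hh : 0 < h) {ρ ρ' : ℤ → ℝ} {g g' : ℤ → ℝ → ℝ} (h1 : IsL2Grid ρ)
    (h2 : IsL2Grid ρ') (h3 : IsL2VelGrid g) (h4 : IsL2VelGrid g') :
    energy ε h (fun i => ρ i - ρ' i) (fun i v => g i v - g' i v)
      ≤ 2 * energy ε h ρ g + 2 * energy ε h ρ' g' := by
  have h2' : Summable fun i => (-1 * ρ' i) ^ 2 := summable_sq_const_mul h2 (-1)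
  have e1 := tsum_sq_add_mul_le hh.le h1 h2' le_rfl le_rfl
  have e2 := ((h3.velBound hh.le).sub hh.le (h4.velBound hh.le)).tsum_le hh
  simp only [neg_mul, one_mul, neg_sq, ← sub_eq_add_neg] at e1
  have e3 := mul_le_mul_of_nonneg_left e2 (sq_nonneg ε)
  unfold energy
  linarith

section error

variable {σ ε T M Δt Δx : ℝ} {ρ : ℝ → Sobolev 3} {g : ℝ → VelSobolev 3} {ρn : ℕ → ℤ → ℝ}
  {gn : ℕ → ℤ → ℝ → ℝ}

/-- The point values of the exact solution perform a perturbed step of the scheme. -/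
theorem exists_isPerturbedStep_exact (hT : 0 < T) (hreg : IsRegular T M ρ g)
    (hs : IsSolution σ ε T ρ g) (hε : 0 < ε) (hk : 0 < Δt) (hh : 0 < Δx) {t : ℝ} (ht : t ∈ Icc 0 T)
    (ht' : t + Δt ∈ Icc 0 T) :
    ∃ e τ, IsPerturbedStep σ ε Δt Δx (fun i => (ρ t).val (i * Δx))
        (fun i => (ρ (t + Δt)).val (i * Δx)) (fun i v => (g t v).val ((i + 1 / 2) * Δx))
        (fun i v => (g (t + Δt) v).val ((i + 1 / 2) * Δx)) e τ ∧
      VelBound Δx τ (2 * (2 * ((ε ^ 2) ^ 2 * (2 * (1 + Δx ^ 2) * (M * Δt) ^ 2))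
          + 2 * (σ ^ 2 * (2 * (1 + Δx ^ 2) * (M * Δt) ^ 2)))
        + 2 * (2 * (Δx ^ 4 * M ^ 2)
          + 2 * (ε ^ 2 * (2 * (Δx ^ 2 * M ^ 2) + 2 * (Δx ^ 2 * M ^ 2))))) ∧
      (Summable fun i => e i ^ 2) ∧
      ∑' i, e i ^ 2 * Δx ≤ 2 * (2 * (1 + Δx ^ 2) * (M * Δt) ^ 2) + 2 * (Δx ^ 4 * M ^ 2) := by
  obtain ⟨e, he1, he2, he3⟩ := exists_macro_residual hT hreg hs hk hh ht ht'
  have hz1 : ‖inclVel (g (t + Δt)) - inclVel (g t)‖ ≤ M * Δt := by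
    have := hreg.g_C2_H1.norm_sub_le ht ht'
    rwa [add_sub_cancel_left, abs_of_pos hk] at this
  exact ⟨e, _, ⟨he3, micro_eq_exact hs hε hk hh ht, fun i => hs.velAvg_val_eq_zero ht' _⟩,
    velBound_microResidual σ ε hh
      (hreg.g_C2_H1.norm_diffQuot_sub_le hT hk ht ht' ⟨le_rfl, by linarith⟩)
      hz1 (hreg.rho_C0_H3.norm_le ht) (hreg.g_C0_H3.norm_le ht), he1, he2⟩

theorem HasExactInitialData.velAvg_eq_zero (hi : HasExactInitialData Δx ρ g ρn gn) (hT : 0 < T)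
    (hs : IsSolution σ ε T ρ g) (i : ℤ) : velAvg (gn 0 i) = 0 :=
  (velAvg_congr (hi.2 i)).trans (hs.velAvg_val_eq_zero ⟨le_rfl, hT.le⟩ _)

theorem isL2_numerical (hT : 0 < T) (hreg : IsRegular T M ρ g) (hs : IsSolution σ ε T ρ g)
    (hσ : 0 < σ) (hε : 0 < ε) (hk : 0 < Δt) (hh : 0 < Δx) (hsch : IsScheme σ ε Δt Δx ρn gn)
    (hi : HasExactInitialData Δx ρ g ρn gn) (n : ℕ) : IsL2Grid (ρn n) ∧ IsL2VelGrid (gn n) :=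
  hsch.isL2 hσ hε hk hh (hi.velAvg_eq_zero hT hs)
    (by rw [funext hi.1]; exact isL2Grid_exact hh 0)
    (((velBound_exact hreg hh ⟨le_rfl, hT.le⟩).isL2VelGrid hh).congr fun i =>
      (Filter.EventuallyEq.symm (hi.2 i))) n

theorem isL2_error (hT : 0 < T) (hreg : IsRegular T M ρ g) (hs : IsSolution σ ε T ρ g)
    (hσ : 0 < σ) (hε : 0 < ε) (hk : 0 < Δt) (hh : 0 < Δx) (hsch : IsScheme σ ε Δt Δx ρn gn)
    (hi : HasExactInitialData Δx ρ g ρn gn) {n : ℕ} (hn : n * Δt ≤ T) :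
    IsL2Grid (rhoError Δt Δx ρ ρn n) ∧ IsL2VelGrid (gError Δt Δx g gn n) := by
  obtain ⟨h1, h2⟩ := isL2_numerical hT hreg hs hσ hε hk hh hsch hi n
  have ht : n * Δt ∈ Icc 0 T := ⟨by positivity, hn⟩
  exact ⟨summable_sq_sub (isL2Grid_exact hh _) h1,
    ((velBound_exact hreg hh ht).isL2VelGrid hh).sub h2⟩

/-- Stability and consistency bound the error in terms of the residuals. -/
theorem energy_error_le (hT : 0 < T) (hreg : IsRegular T M ρ g) (hs : IsSolution σ ε T ρ g)
    (hσ : 0 < σ) (hε : 0 < ε) (hk : 0 < Δt) (hh : 0 < Δx)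
    (hCFL : Δt ≤ Δx ^ 2 * σ / 6 + 2 / 3 * ε * Δx) (hsch : IsScheme σ ε Δt Δx ρn gn)
    (hi : HasExactInitialData Δx ρ g ρn gn) {n : ℕ} (hn : n * Δt ≤ T) :
    energy ε Δx (rhoError Δt Δx ρ ρn n) (gError Δt Δx g gn n) ≤
      Real.exp T * (T * ((2 * (2 * ((ε ^ 2) ^ 2 * (2 * (1 + Δx ^ 2) * (M * Δt) ^ 2))
          + 2 * (σ ^ 2 * (2 * (1 + Δx ^ 2) * (M * Δt) ^ 2)))
        + 2 * (2 * (Δx ^ 4 * M ^ 2)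
          + 2 * (ε ^ 2 * (2 * (Δx ^ 2 * M ^ 2) + 2 * (Δx ^ 2 * M ^ 2))))) / σ
        + (1 + T) * (2 * (2 * (1 + Δx ^ 2) * (M * Δt) ^ 2) + 2 * (Δx ^ 4 * M ^ 2)))) := by
  have hle : ∀ m ≤ n, (m:ℝ) * Δt ∈ Icc 0 T := fun m hm =>
    ⟨by positivity, (mul_le_mul_of_nonneg_right (by exact_mod_cast hm) hk.le).trans hn⟩
  have h0 : energy ε Δx (rhoError Δt Δx ρ ρn 0) (gError Δt Δx g gn 0) = 0 := by
    rw [energy_congr (ρ' := fun _ => 0) (g' := fun _ _ => 0)]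
    · simp [energy, velAvg]
    · intro i
      simp [rhoError, hi.1 i]
    · intro i
      filter_upwards [hi.2 i] with v hv
      simp [gError, hv]
  have := energy_le_of_isPerturbedStep (ρ := rhoError Δt Δx ρ ρn) (g := gError Δt Δx g gn)
    (n := n) hσ hε hk hh hT.le hCFL
    (A := 2 * (2 * ((ε ^ 2) ^ 2 * (2 * (1 + Δx ^ 2) * (M * Δt) ^ 2))
          + 2 * (σ ^ 2 * (2 * (1 + Δx ^ 2) * (M * Δt) ^ 2)))
        + 2 * (2 * (Δx ^ 4 * M ^ 2)
          + 2 * (ε ^ 2 * (2 * (Δx ^ 2 * M ^ 2) + 2 * (Δx ^ 2 * M ^ 2)))))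
    (B := 2 * (2 * (1 + Δx ^ 2) * (M * Δt) ^ 2) + 2 * (Δx ^ 4 * M ^ 2))
    (by positivity) (by positivity)
    (fun m hm => isL2_error hT hreg hs hσ hε hk hh hsch hi (hle m hm).2) (fun m hm => by
      have e : ((m + 1 : ℕ) : ℝ) * Δt = m * Δt + Δt := by push_cast; ring
      have ht' := hle (m + 1) hm
      obtain ⟨r, τ, h1, h2⟩ := exists_isPerturbedStep_exact hT hreg hs hε hk hh (hle m hm.le)
        (e ▸ ht')
      rw [← e] at h1
      exact ⟨r, τ, h1.sub (hsch.isPerturbedStep hε hk hh (hi.velAvg_eq_zero hT hs) m)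
        (velBound_exact hreg hh ht').memLp (hsch.memLp (m + 1)), h2⟩) hn
  rwa [h0, zero_add] at this

/-- The stability of the scheme alone bounds the error by the size of the data. -/
theorem energy_error_le_of_stability (hT : 0 < T) (hreg : IsRegular T M ρ g)
    (hs : IsSolution σ ε T ρ g) (hσ : 0 < σ) (hε : 0 < ε) (hk : 0 < Δt) (hh : 0 < Δx)
    (hCFL : Δt ≤ Δx ^ 2 * σ / 6 + 2 / 3 * ε * Δx) (hsch : IsScheme σ ε Δt Δx ρn gn)
    (hi : HasExactInitialData Δx ρ g ρn gn) {n : ℕ} (hn : n * Δt ≤ T) :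
    energy ε Δx (rhoError Δt Δx ρ ρn n) (gError Δt Δx g gn n) ≤
      4 * Real.exp T * ((1 + ε ^ 2) * (2 * (1 + Δx ^ 2) * M ^ 2)) := by
  have h0 : (0:ℝ) ∈ Icc 0 T := ⟨le_rfl, hT.le⟩
  have ht : (n:ℝ) * Δt ∈ Icc 0 T := ⟨by positivity, hn⟩
  have hnum := isL2_numerical hT hreg hs hσ hε hk hh hsch hi
  have h1 := energy_le_of_isPerturbedStep (ρ := ρn) (g := gn) (n := n) hσ hε hk hh hT.le hCFL
    (A := 0) (B := 0) le_rfl le_rfl (fun m _ => hnum m) (fun m _ =>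
      ⟨_, _, hsch.isPerturbedStep hε hk hh (hi.velAvg_eq_zero hT hs) m,
        ⟨fun _ => memLp_const 0, fun F => by simp [velAvg]⟩, by simp, by simp⟩) hn
  rw [energy_congr hi.1 hi.2, zero_div, mul_zero, add_zero, mul_zero, add_zero] at h1
  have h2 := energy_exact_le (ε := ε) hreg hh h0
  have h3 := energy_exact_le (ε := ε) hreg hh ht
  have h4 := energy_sub_le (ε := ε) hh (isL2Grid_exact (ρ := ρ) hh (n * Δt)) (hnum n).1
    ((velBound_exact hreg hh ht).isL2VelGrid hh) (hnum n).2
  have h5 : 1 ≤ Real.exp T := Real.one_le_exp hT.le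
  have h6 : 0 ≤ (1 + ε ^ 2) * (2 * (1 + Δx ^ 2) * M ^ 2) := by positivity
  refine h4.trans ?_
  nlinarith [mul_le_mul_of_nonneg_left h2 (Real.exp_pos T).le]

end error

/-- The squares of the consistency errors on a grid of step at most `1`. -/
theorem residual_bound_le {σ T M ε k h δ : ℝ} (hσ : 0 < σ) (hT : 0 < T) (hε : 0 < ε) (hk : 0 < k)
    (hh : 0 < h) (hh1 : h ≤ 1) (hδ : δ = (1 + ε ^ 2) * k + h ^ 2 + ε * h) :
    T * ((2 * (2 * ((ε ^ 2) ^ 2 * (2 * (1 + h ^ 2) * (M * k) ^ 2))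
          + 2 * (σ ^ 2 * (2 * (1 + h ^ 2) * (M * k) ^ 2)))
        + 2 * (2 * (h ^ 4 * M ^ 2)
          + 2 * (ε ^ 2 * (2 * (h ^ 2 * M ^ 2) + 2 * (h ^ 2 * M ^ 2))))) / σ
        + (1 + T) * (2 * (2 * (1 + h ^ 2) * (M * k) ^ 2) + 2 * (h ^ 4 * M ^ 2)))
      ≤ T * ((36 + 16 * σ ^ 2) * M ^ 2 / σ + (1 + T) * (10 * M ^ 2)) * δ ^ 2 := by
  have q1 : 0 ≤ ε ^ 2 * k := by positivity
  have q2 : 0 ≤ ε * h := by positivity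
  have q3 : 0 ≤ h ^ 2 := by positivity
  have p1 : k ^ 2 ≤ δ ^ 2 := pow_le_pow_left₀ hk.le (by rw [hδ]; linarith) 2
  have p2 : (ε ^ 2 * k) ^ 2 ≤ δ ^ 2 := pow_le_pow_left₀ q1 (by rw [hδ]; linarith) 2
  have p3 : (h ^ 2) ^ 2 ≤ δ ^ 2 := pow_le_pow_left₀ q3 (by rw [hδ]; linarith) 2
  have p4 : (ε * h) ^ 2 ≤ δ ^ 2 := pow_le_pow_left₀ q2 (by rw [hδ]; linarith) 2
  have p5 : 1 + h ^ 2 ≤ 2 := by nlinarith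
  have hM := sq_nonneg M
  have hA : 2 * (2 * ((ε ^ 2) ^ 2 * (2 * (1 + h ^ 2) * (M * k) ^ 2))
          + 2 * (σ ^ 2 * (2 * (1 + h ^ 2) * (M * k) ^ 2)))
        + 2 * (2 * (h ^ 4 * M ^ 2)
          + 2 * (ε ^ 2 * (2 * (h ^ 2 * M ^ 2) + 2 * (h ^ 2 * M ^ 2))))
        ≤ (36 + 16 * σ ^ 2) * M ^ 2 * δ ^ 2 := by
    calc _ ≤ 2 * (2 * ((ε ^ 2) ^ 2 * (2 * 2 * (M * k) ^ 2))
          + 2 * (σ ^ 2 * (2 * 2 * (M * k) ^ 2)))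
        + 2 * (2 * (h ^ 4 * M ^ 2)
          + 2 * (ε ^ 2 * (2 * (h ^ 2 * M ^ 2) + 2 * (h ^ 2 * M ^ 2)))) := by gcongr
      _ = M ^ 2 * (16 * (ε ^ 2 * k) ^ 2 + 16 * σ ^ 2 * k ^ 2 + 4 * (h ^ 2) ^ 2
          + 16 * (ε * h) ^ 2) := by ring
      _ ≤ M ^ 2 * (16 * δ ^ 2 + 16 * σ ^ 2 * δ ^ 2 + 4 * δ ^ 2 + 16 * δ ^ 2) := by gcongr
      _ = _ := by ring
  have hB : 2 * (2 * (1 + h ^ 2) * (M * k) ^ 2) + 2 * (h ^ 4 * M ^ 2) ≤ 10 * M ^ 2 * δ ^ 2 := by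
    calc _ ≤ 2 * (2 * 2 * (M * k) ^ 2) + 2 * (h ^ 4 * M ^ 2) := by gcongr
      _ = M ^ 2 * (8 * k ^ 2 + 2 * (h ^ 2) ^ 2) := by ring
      _ ≤ M ^ 2 * (8 * δ ^ 2 + 2 * δ ^ 2) := by gcongr
      _ = _ := by ring
  calc _ ≤ T * ((36 + 16 * σ ^ 2) * M ^ 2 * δ ^ 2 / σ + (1 + T) * (10 * M ^ 2 * δ ^ 2)) := by gcongr
    _ = _ := by ring

/-- On a coarse grid the data are bounded by the right-hand side of the error estimate. -/
theorem data_bound_le {M ε k h δ : ℝ} (hε : 0 < ε) (hk : 0 < k) (hh1 : 1 ≤ h)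
    (hδ : δ = (1 + ε ^ 2) * k + h ^ 2 + ε * h) :
    (1 + ε ^ 2) * (2 * (1 + h ^ 2) * M ^ 2) ≤ 8 * M ^ 2 * δ ^ 2 := by
  have hh : 0 < h := by linarith
  have hp : 0 < (1 + ε ^ 2) * k := by positivity
  have p3 : h ^ 2 ≤ δ ^ 2 :=
    pow_le_pow_left₀ hh.le (by rw [hδ]; nlinarith [mul_pos hε hh]) 2
  have p4 : (ε * h) ^ 2 ≤ δ ^ 2 :=
    pow_le_pow_left₀ (by positivity) (by rw [hδ]; nlinarith [sq_nonneg h]) 2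
  have hM := sq_nonneg M
  calc (1 + ε ^ 2) * (2 * (1 + h ^ 2) * M ^ 2) ≤ (1 + ε ^ 2) * (2 * (h ^ 2 + h ^ 2) * M ^ 2) := by
        gcongr
        nlinarith
    _ = M ^ 2 * (4 * h ^ 2 + 4 * (ε * h) ^ 2) := by ring
    _ ≤ M ^ 2 * (4 * δ ^ 2 + 4 * δ ^ 2) := by gcongr
    _ = _ := by ring

end MicroMacro

open MicroMacro in
theorem theorem2 (σ T M : ℝ) (hσ : 0 < σ) (hT : 0 < T) :
    ∃ C : ℝ, ∀ ε Δt Δx : ℝ, 0 < ε → 0 < Δt → 0 < Δx →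
      Δt ≤ Δx ^ 2 * σ / 6 + 2 / 3 * ε * Δx →
      ∀ (ρ : ℝ → Sobolev 3) (g : ℝ → VelSobolev 3),
        IsRegular T M ρ g → IsSolution σ ε T ρ g →
      ∀ (ρn : ℕ → ℤ → ℝ) (gn : ℕ → ℤ → ℝ → ℝ),
        IsScheme σ ε Δt Δx ρn gn → HasExactInitialData Δx ρ g ρn gn →
      ∀ n : ℕ, n * Δt ≤ T →
        IsL2Grid (rhoError Δt Δx ρ ρn n) ∧
        IsL2VelGrid (gError Δt Δx g gn n) ∧
        gridNorm Δx (rhoError Δt Δx ρ ρn n) + ε * velGridNorm Δx (gError Δt Δx g gn n)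
          ≤ C * ((1 + ε ^ 2) * Δt + Δx ^ 2 + ε * Δx) := by
  set K₁ : ℝ := Real.exp T * (T * ((36 + 16 * σ ^ 2) * M ^ 2 / σ + (1 + T) * (10 * M ^ 2))) with hK₁
  set K₂ : ℝ := 32 * Real.exp T * M ^ 2 with hK₂
  have hK₁0 : 0 ≤ K₁ := by positivity
  have hK₂0 : 0 ≤ K₂ := by positivity
  refine ⟨2 * √(K₁ + K₂), ?_⟩
  intro ε Δt Δx hε hk hh hCFL ρ g hreg hs ρn gn hsch hi n hn
  obtain ⟨h1, h2⟩ := isL2_error hT hreg hs hσ hε hk hh hsch hi hn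
  refine ⟨h1, h2, ?_⟩
  obtain ⟨δ, hδ⟩ : ∃ δ, δ = (1 + ε ^ 2) * Δt + Δx ^ 2 + ε * Δx := ⟨_, rfl⟩
  have hδ0 : 0 ≤ δ := by rw [hδ]; positivity
  have hE : energy ε Δx (rhoError Δt Δx ρ ρn n) (gError Δt Δx g gn n) ≤ (K₁ + K₂) * δ ^ 2 := by
    rcases le_total Δx 1 with hx | hx
    · have h3 := energy_error_le hT hreg hs hσ hε hk hh hCFL hsch hi hn
      have h4 := mul_le_mul_of_nonneg_left
        (residual_bound_le (M := M) hσ hT hε hk hh hx hδ) (Real.exp_pos T).le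
      have h5 := mul_nonneg hK₂0 (sq_nonneg δ)
      rw [add_mul, hK₁]
      linarith
    · have h3 := energy_error_le_of_stability hT hreg hs hσ hε hk hh hCFL hsch hi hn
      have h4 := mul_le_mul_of_nonneg_left
        (data_bound_le (M := M) hε hk hx hδ) (by positivity : 0 ≤ 4 * Real.exp T)
      have h5 := mul_nonneg hK₁0 (sq_nonneg δ)
      rw [add_mul, hK₂]
      linarith
  calc _ ≤ 2 * √(energy ε Δx (rhoError Δt Δx ρ ρn n) (gError Δt Δx g gn n)) :=
        gridNorm_add_velGridNorm_le hε.le hh.le _ _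
    _ ≤ 2 * √((K₁ + K₂) * δ ^ 2) := by gcongr
    _ = 2 * √(K₁ + K₂) * ((1 + ε ^ 2) * Δt + Δx ^ 2 + ε * Δx) := by
        rw [Real.sqrt_mul (by positivity), Real.sqrt_sq hδ0, hδ]
        ring
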